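/- **Theorem 1 (True feature recovery for OLS-th).** Let $n,p\ge 1$, let $\mathbf\Sigma\in\mathbb R^{p\times p}$ be symmetric positive semidefinite, $\boldsymbol\beta^*\in\mathbb R^p$ fixed, $\sigma\ge 0$ and $\alpha\in(0,1]$. Consider the linear model $\mathbf y=\mathbf X\boldsymbol\beta^*+\boldsymbol\epsilon$, where the rows $\mathbf x_1,\dots,\mathbf x_n$ of the data matrix $\mathbf X\in\mathbb R^{n\times p}$ are independent with law $\mathcal N(0,\mathbf\Sigma)$ and $\boldsymbol\epsilon\sim\mathcal N(0,\sigma^2\mathbf I_n)$ is independent of $\mathbf X$. Let $S_{\boldsymbol\beta^*}=\{j:\beta^*_j\ne 0\}$, $k^*=|S_{\boldsymbol\beta^*}|$, let $\sqrt{\mathbf\Sigma}$ be the positive semidefinite square root of $\mathbf\Sigma$, $\lambda_{\min}$ the smallest eigenvalue, and $\rho(\mathbf\Sigma)\ge 0$ the number whose square is the largest diagonal entry of $\mathbf\Sigma$, i.e. $\rho^2(\mathbf\Sigma)=\max_j\Sigma_{jj}$. Put $$\lambda=0.9\,\lambda_{\min}(\sqrt{\mathbf\Sigma})-\rho(\mathbf\Sigma)\sqrt{\frac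 pn}$$ and assume that $\lambda>0$ and $$\min_{j\in S_{\boldsymbol\beta^*}}|\beta^*_j|>\frac{4\sigma}{\lambda}\sqrt{\frac{\log p}{n^{\alpha}}}.$$ Then, with probability at least $$1-2p^{\,1-2n^{1-\alpha}}-e^{-n/200},$$ the matrix $\mathbf X^T\mathbf X$ is invertible and the index set of the $k^*$ largest values of $|\hat\beta_j|$ is exactly $S_{\boldsymbol\beta^*}$, where $\hat{\boldsymbol\beta}=(\mathbf X^T\mathbf X)^{-1}\mathbf X^T\mathbf y$ is the ordinary least squares estimate. -/

import Mathlib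

open MeasureTheory ProbabilityTheory
open scoped Matrix MatrixOrder

/-- The smallest eigenvalue of a real symmetric matrix. -/
noncomputable def minEigenvalue {p : ℕ} (A : Matrix (Fin p) (Fin p) ℝ) : ℝ :=
  sInf (spectrum ℝ A)

/-- `ρ(Σ)`: the number whose square is the largest diagonal entry of `Σ`. -/
noncomputable def rhoDiag {p : ℕ} (S : Matrix (Fin p) (Fin p) ℝ) : ℝ :=
  Real.sqrt (⨆ j, S j j)

/-- The data matrix, whose rows are the observations `x 0, …, x (n - 1)`. -/
def dataMatrix {n p : ℕ} (x : Fin n → EuclideanSpace ℝ (Fin p)) :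
    Matrix (Fin n) (Fin p) ℝ :=
  Matrix.of fun i j => x i j

/-- The response `y = X β + ε` of the linear model. -/
def response {n p : ℕ} (X : Matrix (Fin n) (Fin p) ℝ) (β : Fin p → ℝ)
    (e : EuclideanSpace ℝ (Fin n)) : Fin n → ℝ :=
  fun i => (X *ᵥ β) i + e i

/-- The ordinary least squares estimate `(Xᵀ X)⁻¹ Xᵀ y`; meaningful when `Xᵀ X` is invertible,
in which case it is the unique solution of the normal equations `Xᵀ X b = Xᵀ y`. -/
noncomputable def olsEstimate {n p : ℕ} (X : Matrix (Fin n) (Fin p) ℝ) (y : Fin n → ℝ) :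
    Fin p → ℝ :=
  (Xᵀ * X)⁻¹ *ᵥ (Xᵀ *ᵥ y)

/-- The support `{j | β j ≠ 0}`. -/
noncomputable def coeffSupport {p : ℕ} (β : Fin p → ℝ) : Finset (Fin p) :=
  Finset.univ.filter fun j => β j ≠ 0

/-- `T` is a set of indices of `k` largest values of `|b j|` (ties may be broken arbitrarily). -/
def IsTopIndexSet {p : ℕ} (k : ℕ) (b : Fin p → ℝ) (T : Finset (Fin p)) : Prop :=
  T.card = k ∧ ∀ i ∈ T, ∀ j ∉ T, |b j| ≤ |b i|

/-- The index set of the `k` largest values of `|b j|` is exactly `T`: whichever way ties are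
broken, the outcome is `T`. -/
def TopIndexSetIs {p : ℕ} (k : ℕ) (b : Fin p → ℝ) (T : Finset (Fin p)) : Prop :=
  ∀ T' : Finset (Fin p), IsTopIndexSet k b T' ↔ T' = T

/-! Everything reduces to a lower bound `s = √n λ` for the smallest singular value of `X`. Once `s
‖v‖ ≤ ‖X v‖` holds for all `v`, the Gram matrix is invertible and the rows of `(Xᵀ X)⁻¹ Xᵀ` have
norm at most `1 / s` (`norm_olsRow_le`). The error of each coordinate of the estimate, given `X`, is
then centred Gaussian with standard deviation at most `σ / s`. A union bound over `p` coordinates at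
level `t = 2 √(n log p / n ^ α)` fails with probability at most `2 p ^ (1 - 2 n ^ (1 - α))`.
Otherwise every error is at most `(σ / s) t`, half the assumed signal threshold, so coordinates on
the support strictly dominate the others.

For the singular value, write `X = G √Σ` with `G` standard Gaussian. Gordon's comparison bounds the
mean of `min_v max_u ⟨u, G v⟩` below by `chiMean n - chiMean p`, and Gaussian concentration of
`1`-Lipschitz functions costs a deviation `0.1 √n` with probability at most `exp (-n / 200)`. Since
`√n - chiMean n` is nonincreasing, the difference of means is at least `√n - √p`. As `λ_min(√Σ) ≤
ρ(Σ)`, the product `√n (0.9 - √(p / n)) λ_min(√Σ)` is at least `√n λ`.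

Both Gaussian tools come from integration by parts (`stein_identity`) along a rotation.
Concentration interpolates between a point and an independent copy (`integral_rotIntegrand_ge`),
which yields the sharp constant `1 / 2` in the exponent. Gordon's inequality (`gordon_comparison`)
interpolates between two orthogonal families of vectors, with the min-max replaced by a smooth
version on finite sets; finite nets and a dense sequence of directions then recover the whole
sphere. -/

set_option linter.unusedSectionVars false

/-! ### Standard Gaussian measure: density, integration by parts, integrability. -/

section StdGaussian

variable {E : Type*} [NormedAddCommGroup E] [InnerProductSpace ℝ E] [FiniteDimensional ℝ E]
  [MeasurableSpace E] [BorelSpace E]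

variable (E) in
/-- The normalising constant of the standard Gaussian density on `E`. -/
noncomputable def gaussNorm : ℝ := (∫ v : E, Real.exp (-(1 / 2) * ‖v‖ ^ 2))⁻¹

lemma integral_exp_neg_half_sq_pos : 0 < ∫ v : E, Real.exp (-(1 / 2) * ‖v‖ ^ 2) := by
  rw [GaussianFourier.integral_rexp_neg_mul_sq_norm (by norm_num)]
  positivity

lemma integrable_exp_neg_half_sq : Integrable fun v : E => Real.exp (-(1 / 2) * ‖v‖ ^ 2) := by
  by_contra h
  have := integral_exp_neg_half_sq_pos (E := E)
  rw [integral_undef h] at this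
  exact lt_irrefl _ this

lemma gaussNorm_pos : 0 < gaussNorm E := inv_pos.2 integral_exp_neg_half_sq_pos

/-- The standard Gaussian measure has density proportional to `exp (-‖x‖² / 2)`. -/
lemma stdGaussian_eq_withDensity :
    stdGaussian E = (volume : Measure E).withDensity
      fun x => ENNReal.ofReal (gaussNorm E * Real.exp (-(1 / 2) * ‖x‖ ^ 2)) := by
  have hm : Measurable fun x : E => gaussNorm E * Real.exp (-(1 / 2) * ‖x‖ ^ 2) := by fun_prop
  have hpos : ∀ x : E, 0 ≤ gaussNorm E * Real.exp (-(1 / 2) * ‖x‖ ^ 2) := fun x =>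
    mul_nonneg gaussNorm_pos.le (Real.exp_pos _).le
  have hfin : IsFiniteMeasure ((volume : Measure E).withDensity
      fun x => ENNReal.ofReal (gaussNorm E * Real.exp (-(1 / 2) * ‖x‖ ^ 2))) :=
    isFiniteMeasure_withDensity_ofReal
      (integrable_exp_neg_half_sq.const_mul (gaussNorm E)).2
  apply Measure.ext_of_charFun
  ext t
  rw [charFun_stdGaussian, charFun_apply,
    integral_withDensity_eq_integral_toReal_smul (by fun_prop) (by simp)]
  have h1 := GaussianFourier.integral_cexp_neg_mul_sq_norm_add (V := E) (b := (1 / 2 : ℂ))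
    (by norm_num) Complex.I t
  have h2 := GaussianFourier.integral_cexp_neg_mul_sq_norm (V := E) (b := (1 / 2 : ℂ))
    (by norm_num)
  -- The complex Gaussian integral at `t = 0` is the real one defining `gaussNorm`, so the two
  -- constants cancel.
  have h3 : (gaussNorm E : ℂ) * ((Real.pi : ℂ) / (1 / 2)) ^ ((Module.finrank ℝ E : ℂ) / 2) = 1 := by
    rw [← h2, gaussNorm]
    have : (∫ v : E, Complex.exp (-(1 / 2 : ℂ) * (‖v‖ : ℂ) ^ 2))
        = ((∫ v : E, Real.exp (-(1 / 2) * ‖v‖ ^ 2) : ℝ) : ℂ) := by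
      rw [← integral_complex_ofReal]
      congr 1; ext v; push_cast; rfl
    rw [this, Complex.ofReal_inv]
    exact inv_mul_cancel₀ (by exact_mod_cast integral_exp_neg_half_sq_pos.ne')
  have h4 : ∀ x : E, (ENNReal.ofReal (gaussNorm E * Real.exp (-(1 / 2) * ‖x‖ ^ 2))).toReal •
      Complex.exp ((inner ℝ x t : ℂ) * Complex.I) = (gaussNorm E : ℂ) *
      Complex.exp (-(1 / 2 : ℂ) * (‖x‖ : ℂ) ^ 2 + Complex.I * (inner ℝ t x : ℂ)) := by
    intro x
    rw [ENNReal.toReal_ofReal (hpos x), Complex.real_smul, Complex.exp_add, real_inner_comm]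
    push_cast
    rw [mul_comm Complex.I]
    ring
  simp_rw [h4]
  rw [integral_const_mul, h1, ← mul_assoc, h3, one_mul, Complex.I_sq]
  congr 1
  ring

lemma integral_stdGaussian_eq (f : E → ℝ) :
    ∫ x, f x ∂stdGaussian E
      = gaussNorm E * ∫ x, f x * Real.exp (-(1 / 2) * ‖x‖ ^ 2) := by
  rw [stdGaussian_eq_withDensity,
    integral_withDensity_eq_integral_toReal_smul (by fun_prop) (by simp), ← integral_const_mul]
  congr 1; ext x
  rw [ENNReal.toReal_ofReal (mul_nonneg gaussNorm_pos.le (Real.exp_pos _).le), smul_eq_mul]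
  ring

lemma integrable_stdGaussian_iff (f : E → ℝ) :
    Integrable f (stdGaussian E)
      ↔ Integrable fun x => f x * Real.exp (-(1 / 2) * ‖x‖ ^ 2) := by
  rw [stdGaussian_eq_withDensity,
    integrable_withDensity_iff_integrable_smul' (by fun_prop) (by simp)]
  have : (fun x : E => (ENNReal.ofReal (gaussNorm E * Real.exp (-(1 / 2) * ‖x‖ ^ 2))).toReal • f x)
      = fun x => gaussNorm E * (f x * Real.exp (-(1 / 2) * ‖x‖ ^ 2)) := by
    ext x
    rw [ENNReal.toReal_ofReal (mul_nonneg gaussNorm_pos.le (Real.exp_pos _).le), smul_eq_mul]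
    ring
  rw [this, integrable_const_mul_iff (isUnit_iff_ne_zero.2 gaussNorm_pos.ne')]

/-- Gaussian integration by parts. -/
lemma stein_identity {h h' : E → ℝ} {a : E} (hd : ∀ x, HasLineDerivAt ℝ h (h' x) x a)
    (h1 : Integrable h (stdGaussian E)) (h2 : Integrable h' (stdGaussian E))
    (h3 : Integrable (fun x => inner ℝ a x * h x) (stdGaussian E)) :
    ∫ x, inner ℝ a x * h x ∂stdGaussian E = ∫ x, h' x ∂stdGaussian E := by
  rw [integrable_stdGaussian_iff] at h1 h2 h3
  rw [integral_stdGaussian_eq, integral_stdGaussian_eq]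
  congr 1
  have hg : ∀ x : E, HasLineDerivAt ℝ (fun x : E => Real.exp (-(1 / 2) * ‖x‖ ^ 2))
      (-(inner ℝ a x * Real.exp (-(1 / 2) * ‖x‖ ^ 2))) x a := by
    intro x
    have := ((((hasFDerivAt_id x).norm_sq).const_mul (-(1 / 2 : ℝ))).exp).hasLineDerivAt a
    convert! this using 1
    simp [real_inner_comm]
    ring
  have := integral_bilinear_hasLineDerivAt_right_eq_neg_left_of_integrable
    (μ := (volume : Measure E)) (B := ContinuousLinearMap.mul ℝ ℝ) (f := h) (f' := h')
    (g := fun x : E => Real.exp (-(1 / 2) * ‖x‖ ^ 2)) (v := a)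
    (by simpa using h2) (by
      refine (h3.neg).congr (Filter.Eventually.of_forall fun x => ?_)
      simp; ring) (by simpa using h1) (fun x _ => hd x) (fun x _ => hg x)
  simp only [ContinuousLinearMap.mul_apply'] at this
  rw [← neg_inj, ← this, ← integral_neg]
  congr 1; ext x; ring

/-- Fernique's theorem makes `exp (C ‖x‖²)` integrable for some `C > 0`, and completing the square
gives `c ‖x‖ ≤ c² / (4 C) + C ‖x‖²`. -/
lemma integrable_exp_norm_stdGaussian (c : ℝ) :
    Integrable (fun x : E => Real.exp (c * ‖x‖)) (stdGaussian E) := by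
  obtain ⟨C, hC, hi⟩ := IsGaussian.exists_integrable_exp_sq (stdGaussian E)
  refine (hi.const_mul (Real.exp (c ^ 2 / (4 * C)))).mono' (by fun_prop)
    (Filter.Eventually.of_forall fun x => ?_)
  rw [Real.norm_eq_abs, abs_of_pos (Real.exp_pos _), ← Real.exp_add]
  apply Real.exp_le_exp.2
  have : c ^ 2 / (4 * C) + C * ‖x‖ ^ 2 - c * ‖x‖ = (2 * C * ‖x‖ - c) ^ 2 / (4 * C) := by
    field_simp; ring
  have h2 : 0 ≤ (2 * C * ‖x‖ - c) ^ 2 / (4 * C) := by positivity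
  linarith

lemma integrable_norm_mul_exp_norm_stdGaussian (c : ℝ) :
    Integrable (fun x : E => ‖x‖ * Real.exp (c * ‖x‖)) (stdGaussian E) := by
  refine (integrable_exp_norm_stdGaussian (c + 1)).mono' (by fun_prop)
    (Filter.Eventually.of_forall fun x => ?_)
  rw [Real.norm_eq_abs, abs_of_nonneg (by positivity), add_mul, Real.exp_add, mul_comm, one_mul]
  gcongr
  linarith [Real.add_one_le_exp ‖x‖]

lemma integrable_norm_stdGaussian : Integrable (fun x : E => ‖x‖) (stdGaussian E) :=
  IsGaussian.integrable_id.norm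

/-- A coisometry maps the standard Gaussian measure to the standard Gaussian measure. -/
lemma stdGaussian_map_of_adjoint_norm {F : Type*} [NormedAddCommGroup F] [InnerProductSpace ℝ F]
    [FiniteDimensional ℝ F] [MeasurableSpace F] [BorelSpace F] (T : E →L[ℝ] F) (T' : F → E)
    (hT : ∀ x y, inner ℝ (T x) y = inner ℝ x (T' y)) (hn : ∀ y, ‖T' y‖ = ‖y‖) :
    (stdGaussian E).map T = stdGaussian F := by
  have : IsProbabilityMeasure ((stdGaussian E).map T) :=
    Measure.isProbabilityMeasure_map (by fun_prop)
  apply Measure.ext_of_charFun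
  ext t
  rw [charFun_stdGaussian, charFun_apply, integral_map (by fun_prop) (by fun_prop)]
  simp_rw [hT]
  rw [← charFun_apply, charFun_stdGaussian, hn]

end StdGaussian

/-! ### Gaussian concentration for smooth `1`-Lipschitz functions. -/

section Concentration

variable {E : Type*} [NormedAddCommGroup E] [InnerProductSpace ℝ E] [FiniteDimensional ℝ E]
  [MeasurableSpace E] [BorelSpace E] {F : E → ℝ}

lemma abs_le_add_norm_of_fderiv_le (hF : ContDiff ℝ 1 F) (hL : ∀ x, ‖fderiv ℝ F x‖ ≤ 1) (x : E) :
    |F x| ≤ |F 0| + ‖x‖ := by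
  have h := lipschitzWith_of_nnnorm_fderiv_le (C := 1) (hF.differentiable one_ne_zero)
    (fun x => by exact_mod_cast hL x)
  have := h.dist_le_mul x 0
  simp only [Real.dist_eq, NNReal.coe_one, one_mul, dist_zero_right] at this
  have h2 := abs_sub_abs_le_abs_sub (F x) (F 0)
  linarith

lemma exp_mul_le_of_fderiv_le (hF : ContDiff ℝ 1 F) (hL : ∀ x, ‖fderiv ℝ F x‖ ≤ 1) (θ : ℝ) (x : E) :
    Real.exp (θ * F x) ≤ Real.exp (|θ| * |F 0|) * Real.exp (|θ| * ‖x‖) := by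
  rw [← Real.exp_add, ← mul_add]
  apply Real.exp_le_exp.2
  calc θ * F x ≤ |θ * F x| := le_abs_self _
    _ = |θ| * |F x| := abs_mul _ _
    _ ≤ _ := by gcongr; exact abs_le_add_norm_of_fderiv_le hF hL x

lemma integrable_exp_mul_of_fderiv_le (hF : ContDiff ℝ 1 F) (hL : ∀ x, ‖fderiv ℝ F x‖ ≤ 1)
    (θ : ℝ) : Integrable (fun x => Real.exp (θ * F x)) (stdGaussian E) := by
  have hc := hF.continuous
  refine ((integrable_exp_norm_stdGaussian |θ|).const_mul (Real.exp (|θ| * |F 0|))).mono'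
    (by fun_prop) (Filter.Eventually.of_forall fun x => ?_)
  rw [Real.norm_eq_abs, abs_of_pos (Real.exp_pos _)]
  exact exp_mul_le_of_fderiv_le hF hL θ x

lemma stdGaussian_prod_map_rotation (s : ℝ) :
    ((stdGaussian E).prod (stdGaussian E)).map (ContinuousLinearMap.rotation s)
      = (stdGaussian E).prod (stdGaussian E) :=
  IsGaussian.map_rotation_eq_self (by simp) s

lemma integrable_exp_mul_norm_prod (c : ℝ) :
    Integrable (fun z : E × E => Real.exp (c * ‖z.1‖) * (‖z.1‖ + ‖z.2‖))
      ((stdGaussian E).prod (stdGaussian E)) := by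
  have h1 := (integrable_norm_mul_exp_norm_stdGaussian (E := E) c).mul_prod
    (integrable_const (μ := stdGaussian E) (1 : ℝ))
  have h2 := (integrable_exp_norm_stdGaussian (E := E) c).mul_prod
    (integrable_norm_stdGaussian (E := E))
  refine (h1.add h2).congr (Filter.Eventually.of_forall fun z => ?_)
  simp only [Pi.add_apply]; ring

lemma norm_cos_smul_add_sin_smul_le (s : ℝ) (x y : E) :
    ‖-Real.sin s • x + Real.cos s • y‖ ≤ ‖x‖ + ‖y‖ := by
  refine (norm_add_le _ _).trans (add_le_add ?_ ?_)
  · rw [norm_smul, norm_neg]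
    exact mul_le_of_le_one_left (norm_nonneg _) (Real.abs_sin_le_one s)
  · rw [norm_smul]
    exact mul_le_of_le_one_left (norm_nonneg _) (Real.abs_cos_le_one s)

/-- The derivative of the integrand in the covariance interpolation. -/
noncomputable def rotIntegrand (F : E → ℝ) (θ s : ℝ) (z : E × E) : ℝ :=
  Real.exp (θ * F z.1) * fderiv ℝ F (Real.cos s • z.1 + Real.sin s • z.2)
    (-Real.sin s • z.1 + Real.cos s • z.2)

lemma abs_rotIntegrand_le (hF : ContDiff ℝ 1 F) (hL : ∀ x, ‖fderiv ℝ F x‖ ≤ 1) (θ s : ℝ)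
    (z : E × E) : ‖rotIntegrand F θ s z‖ ≤
      Real.exp (|θ| * |F 0|) * (Real.exp (|θ| * ‖z.1‖) * (‖z.1‖ + ‖z.2‖)) := by
  rw [rotIntegrand, norm_mul, Real.norm_eq_abs, abs_of_pos (Real.exp_pos _), ← mul_assoc]
  refine mul_le_mul (exp_mul_le_of_fderiv_le hF hL θ z.1) ?_ (norm_nonneg _) (by positivity)
  refine (ContinuousLinearMap.le_opNorm _ _).trans ?_
  refine (mul_le_of_le_one_left (norm_nonneg _) (hL _)).trans ?_
  exact norm_cos_smul_add_sin_smul_le s _ _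

lemma continuous_rotIntegrand (hF : ContDiff ℝ 1 F) (θ s : ℝ) :
    Continuous (rotIntegrand F θ s) := by
  have hc := hF.continuous
  have hd := hF.continuous_fderiv one_ne_zero
  unfold rotIntegrand
  refine Continuous.mul (by fun_prop) (Continuous.clm_apply (hd.comp (by fun_prop)) (by fun_prop))

lemma integrable_rotIntegrand (hF : ContDiff ℝ 1 F) (hL : ∀ x, ‖fderiv ℝ F x‖ ≤ 1) (θ s : ℝ) :
    Integrable (rotIntegrand F θ s) ((stdGaussian E).prod (stdGaussian E)) :=
  ((integrable_exp_mul_norm_prod |θ|).const_mul _).mono'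
    (continuous_rotIntegrand hF θ s).aestronglyMeasurable
    (Filter.Eventually.of_forall (abs_rotIntegrand_le hF hL θ s))

lemma integrable_exp_mul_comp_rot (hF : ContDiff ℝ 1 F) (hL : ∀ x, ‖fderiv ℝ F x‖ ≤ 1) (θ s : ℝ) :
    Integrable (fun z : E × E => Real.exp (θ * F z.1) *
      F (Real.cos s • z.1 + Real.sin s • z.2)) ((stdGaussian E).prod (stdGaussian E)) := by
  have hc := hF.continuous
  have h2 := (integrable_exp_norm_stdGaussian (E := E) |θ|).mul_prod
    (integrable_const (μ := stdGaussian E) |F 0|)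
  refine (((h2.add (integrable_exp_mul_norm_prod |θ|))).const_mul
    (Real.exp (|θ| * |F 0|))).mono' (by fun_prop) (Filter.Eventually.of_forall fun z => ?_)
  rw [norm_mul, Real.norm_eq_abs, abs_of_pos (Real.exp_pos _), Pi.add_apply, ← mul_add, ← mul_assoc]
  refine mul_le_mul (exp_mul_le_of_fderiv_le hF hL θ z.1) ?_ (norm_nonneg _) (by positivity)
  refine (abs_le_add_norm_of_fderiv_le hF hL _).trans ?_
  gcongr
  refine (norm_add_le _ _).trans (add_le_add ?_ ?_)
  · rw [norm_smul]
    exact mul_le_of_le_one_left (norm_nonneg _) (Real.abs_cos_le_one s)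
  · rw [norm_smul]
    exact mul_le_of_le_one_left (norm_nonneg _) (Real.abs_sin_le_one s)

/-- This function of `s` runs from `E[F exp (θ F)]` at `0` to `E[F] E[exp (θ F)]` at `π / 2`, so its
derivative controls the covariance of `F` and `exp (θ F)`. -/
lemma hasDerivAt_integral_rot (hF : ContDiff ℝ 1 F) (hL : ∀ x, ‖fderiv ℝ F x‖ ≤ 1) (θ s : ℝ) :
    HasDerivAt (fun s => ∫ z : E × E, Real.exp (θ * F z.1) *
      F (Real.cos s • z.1 + Real.sin s • z.2) ∂(stdGaussian E).prod (stdGaussian E))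
      (∫ z, rotIntegrand F θ s z ∂(stdGaussian E).prod (stdGaussian E)) s := by
  refine (hasDerivAt_integral_of_dominated_loc_of_deriv_le (F' := fun s z => rotIntegrand F θ s z)
    (s := Set.univ) (bound := fun z => Real.exp (|θ| * |F 0|) *
      (Real.exp (|θ| * ‖z.1‖) * (‖z.1‖ + ‖z.2‖))) Filter.univ_mem
    (Filter.Eventually.of_forall fun s => (integrable_exp_mul_comp_rot hF hL θ s).1)
    (integrable_exp_mul_comp_rot hF hL θ s)
    (continuous_rotIntegrand hF θ s).aestronglyMeasurable
    (Filter.Eventually.of_forall fun z s _ => abs_rotIntegrand_le hF hL θ s z)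
    ((integrable_exp_mul_norm_prod |θ|).const_mul _)
    (Filter.Eventually.of_forall fun z s _ => ?_)).2
  refine HasDerivAt.const_mul _ ?_
  have h1 : HasDerivAt (fun s => Real.cos s • z.1 + Real.sin s • z.2)
      (-Real.sin s • z.1 + Real.cos s • z.2) s :=
    ((Real.hasDerivAt_cos s).smul_const z.1).add ((Real.hasDerivAt_sin s).smul_const z.2)
  exact ((hF.differentiable one_ne_zero _).hasFDerivAt).comp_hasDerivAt s h1

/-- By rotation invariance the rotated point `y` and its velocity `w` are again independent standard
Gaussians, with the original point equal to `cos s • y - sin s • w`. The integrand becomes linear in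
`w` times an exponential. Integrating by parts in `w` along the gradient of `F` at `y` produces `-θ
sin s` times an inner product of two gradients, each of norm at most `1`. -/
lemma integral_rotIntegrand_ge (hF : ContDiff ℝ 1 F) (hL : ∀ x, ‖fderiv ℝ F x‖ ≤ 1) {θ s : ℝ}
    (hθ : 0 ≤ θ) (hs : 0 ≤ Real.sin s) :
    -(θ * Real.sin s * ∫ x, Real.exp (θ * F x) ∂stdGaussian E) ≤
      ∫ z, rotIntegrand F θ s z ∂(stdGaussian E).prod (stdGaussian E) := by
  have hc := hF.continuous
  have hd := hF.continuous_fderiv one_ne_zero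
  set μ := stdGaussian E
  let back : E × E → E := fun z => Real.cos s • z.1 - Real.sin s • z.2
  have hback : ∀ z : E × E, back (ContinuousLinearMap.rotation s z) = z.1 := by
    intro z
    simp only [back, ContinuousLinearMap.rotation_apply]
    have := Real.sin_sq_add_cos_sq s
    calc _ = (Real.sin s ^ 2 + Real.cos s ^ 2) • z.1 := by module
      _ = z.1 := by rw [this, one_smul]
  let Φ : E × E → ℝ := fun z => Real.exp (θ * F (back z)) * fderiv ℝ F z.1 z.2
  let Ψ : E × E → ℝ := fun z => Real.exp (θ * F (back z))
  have hbc : Continuous back := by fun_prop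
  have hΨc : Continuous Ψ := by fun_prop
  have hΦc : Continuous Φ :=
    hΨc.mul (Continuous.clm_apply (hd.comp continuous_fst) continuous_snd)
  have hΦ : ∀ z, rotIntegrand F θ s z = Φ (ContinuousLinearMap.rotation s z) := by
    intro z
    simp only [Φ, hback]
    rfl
  have hmap := stdGaussian_prod_map_rotation (E := E) s
  have hΦi : Integrable Φ (μ.prod μ) := by
    rw [← hmap, integrable_map_measure (by fun_prop) (by fun_prop)]
    exact (integrable_rotIntegrand hF hL θ s).congr (Filter.Eventually.of_forall hΦ)
  have hΨi : Integrable Ψ (μ.prod μ) := by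
    rw [← hmap, integrable_map_measure (by fun_prop) (by fun_prop)]
    refine ((integrable_exp_mul_of_fderiv_le hF hL θ).comp_fst μ).congr
      (Filter.Eventually.of_forall fun z => ?_)
    simp only [Ψ, Function.comp, hback]
  have e1 : ∫ z, rotIntegrand F θ s z ∂μ.prod μ = ∫ z, Φ z ∂μ.prod μ := by
    conv_rhs => rw [← hmap]
    rw [integral_map (by fun_prop) (by fun_prop)]
    exact integral_congr_ae (Filter.Eventually.of_forall hΦ)
  have e2 : ∫ x, Real.exp (θ * F x) ∂μ = ∫ z, Ψ z ∂μ.prod μ := by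
    conv_rhs => rw [← hmap]
    rw [integral_map (by fun_prop) (by fun_prop)]
    simp only [Ψ, hback]
    rw [integral_fun_fst (fun x => Real.exp (θ * F x))]
    simp [μ]
  rw [e1, e2, integral_prod _ hΦi, integral_prod _ hΨi, ← integral_const_mul, ← integral_neg]
  refine integral_mono_ae (hΨi.integral_prod_left.const_mul _).neg hΦi.integral_prod_left ?_
  filter_upwards [hΨi.prod_right_ae, hΦi.prod_right_ae] with y hy1 hy2
  set a : E := (InnerProductSpace.toDual ℝ E).symm (fderiv ℝ F y) with ha
  have ha1 : ∀ w, inner ℝ a w = fderiv ℝ F y w := fun w =>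
    InnerProductSpace.toDual_symm_apply
  have ha2 : ‖a‖ ≤ 1 := by rw [ha, LinearIsometryEquiv.norm_map]; exact hL y
  let k' : E → ℝ := fun w => Ψ (y, w) * (θ * fderiv ℝ F (back (y, w)) (-(Real.sin s • a)))
  have hder : ∀ w, HasLineDerivAt ℝ (fun w => Ψ (y, w)) (k' w) w a := by
    intro w
    have h1 : HasFDerivAt (fun w : E => back (y, w))
        (-(Real.sin s • ContinuousLinearMap.id ℝ E)) w :=
      ((hasFDerivAt_id w).const_smul (Real.sin s)).const_sub (Real.cos s • y)
    have h2 := ((((hF.differentiable one_ne_zero (back (y, w))).hasFDerivAt.comp w h1).const_mul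
      θ).exp).hasLineDerivAt a
    exact h2
  have hDa : ∀ w, |fderiv ℝ F (back (y, w)) (-(Real.sin s • a))| ≤ Real.sin s := by
    intro w
    refine ((fderiv ℝ F (back (y, w))).le_opNorm _).trans ?_
    refine (mul_le_of_le_one_left (norm_nonneg _) (hL _)).trans ?_
    rw [norm_neg, norm_smul, Real.norm_eq_abs, abs_of_nonneg hs]
    exact mul_le_of_le_one_right hs ha2
  have hk'i : Integrable k' μ := by
    refine (hy1.mul_const (θ * Real.sin s)).mono' ?_ (Filter.Eventually.of_forall fun w => ?_)
    · refine (Continuous.mul (by fun_prop) (continuous_const.mul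
        (Continuous.clm_apply (hd.comp (by fun_prop)) continuous_const))).aestronglyMeasurable
    · simp only [k', norm_mul, Real.norm_eq_abs, abs_of_nonneg hθ]
      rw [abs_of_pos (Real.exp_pos _)]
      exact mul_le_mul_of_nonneg_left (mul_le_mul_of_nonneg_left (hDa w) hθ) (Real.exp_pos _).le
  have hst := stein_identity hder hy1 hk'i (by
    refine hy2.congr (Filter.Eventually.of_forall fun w => ?_)
    simp only [Φ, Ψ, ha1]; ring)
  have e3 : ∫ w, Φ (y, w) ∂μ = ∫ w, k' w ∂μ := by
    rw [← hst]
    congr 1; ext w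
    simp only [Φ, Ψ, ha1]; ring
  rw [e3, ← integral_const_mul, ← integral_neg]
  refine integral_mono (hy1.const_mul _).neg hk'i fun w => ?_
  have h4 := neg_le_of_abs_le (hDa w)
  have h5 : 0 ≤ Ψ (y, w) := (Real.exp_pos _).le
  have h6 := mul_le_mul_of_nonneg_left (mul_le_mul_of_nonneg_left h4 hθ) h5
  simp only [k']
  linarith

/-- The differential inequality `Z' ≤ (m + θ) Z` for the moment generating function: the lower bound
`-θ Z sin s` on the derivative integrates over `[0, π / 2]` to `-θ Z`, which the compensator `θ Z
cos s` records. -/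
lemma integral_mul_exp_le (hF : ContDiff ℝ 1 F) (hL : ∀ x, ‖fderiv ℝ F x‖ ≤ 1) {θ : ℝ}
    (hθ : 0 ≤ θ) :
    ∫ x, F x * Real.exp (θ * F x) ∂stdGaussian E ≤
      (∫ x, F x ∂stdGaussian E + θ) * ∫ x, Real.exp (θ * F x) ∂stdGaussian E := by
  set μ := stdGaussian E
  set Z := ∫ x, Real.exp (θ * F x) ∂μ with hZ
  let H : ℝ → ℝ := fun s => ∫ z : E × E, Real.exp (θ * F z.1) *
      F (Real.cos s • z.1 + Real.sin s • z.2) ∂μ.prod μ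
  have hH : ∀ s, HasDerivAt (fun s => H s - θ * Z * Real.cos s)
      ((∫ z, rotIntegrand F θ s z ∂μ.prod μ) - θ * Z * -Real.sin s) s := fun s =>
    (hasDerivAt_integral_rot hF hL θ s).sub ((Real.hasDerivAt_cos s).const_mul _)
  have hmono : MonotoneOn (fun s => H s - θ * Z * Real.cos s) (Set.Icc 0 (Real.pi / 2)) := by
    refine monotoneOn_of_deriv_nonneg (convex_Icc _ _)
      (fun s _ => (hH s).continuousAt.continuousWithinAt)
      (fun s _ => (hH s).differentiableAt.differentiableWithinAt) fun s hs => ?_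
    rw [interior_Icc] at hs
    rw [(hH s).deriv]
    have := integral_rotIntegrand_ge hF hL hθ
      (Real.sin_nonneg_of_nonneg_of_le_pi hs.1.le (by linarith [hs.2, Real.pi_pos]))
    linarith
  have hle := hmono (Set.left_mem_Icc.2 (by positivity)) (Set.right_mem_Icc.2 (by positivity))
    (by positivity)
  have h0 : H 0 = ∫ x, F x * Real.exp (θ * F x) ∂μ := by
    simp only [H, Real.cos_zero, Real.sin_zero, one_smul, zero_smul, add_zero]
    rw [integral_fun_fst (fun x => Real.exp (θ * F x) * F x)]
    simp [mul_comm]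
  have h1 : H (Real.pi / 2) = Z * ∫ x, F x ∂μ := by
    simp only [H, Real.cos_pi_div_two, Real.sin_pi_div_two, one_smul, zero_smul, zero_add]
    rw [integral_prod_mul (fun x => Real.exp (θ * F x)) F]
  simp only [h0, h1, Real.cos_zero, Real.cos_pi_div_two] at hle
  linarith

/-- Gaussian concentration: the moment generating function of a `1`-Lipschitz function. -/
lemma integral_exp_mul_le (hF : ContDiff ℝ 1 F) (hL : ∀ x, ‖fderiv ℝ F x‖ ≤ 1) {θ : ℝ}
    (hθ : 0 ≤ θ) :
    ∫ x, Real.exp (θ * F x) ∂stdGaussian E ≤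
      Real.exp (θ * ∫ x, F x ∂stdGaussian E + θ ^ 2 / 2) := by
  set μ := stdGaussian E
  set m := ∫ x, F x ∂μ
  have hset : integrableExpSet F μ = Set.univ :=
    Set.eq_univ_of_forall fun t => integrable_exp_mul_of_fderiv_le hF hL t
  have hZ : ∀ t, HasDerivAt (mgf F μ) (∫ x, F x * Real.exp (t * F x) ∂μ) t := fun t =>
    hasDerivAt_mgf (by rw [hset]; simp)
  -- Gronwall: `integral_mul_exp_le` makes this product nonincreasing on `t ≥ 0`, and it equals `1`
  -- at `t = 0`.
  have hg : ∀ t, HasDerivAt (fun t => mgf F μ t * Real.exp (-(t * m + t ^ 2 / 2)))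
      ((∫ x, F x * Real.exp (t * F x) ∂μ) * Real.exp (-(t * m + t ^ 2 / 2))
        + mgf F μ t * (Real.exp (-(t * m + t ^ 2 / 2)) * (-(m + t)))) t := by
    intro t
    refine (hZ t).mul (HasDerivAt.exp ?_)
    refine HasDerivAt.neg ?_
    have h1 := (hasDerivAt_id t).mul_const m
    have h2 := ((hasDerivAt_id t).pow 2).div_const 2
    convert! h1.add h2 using 1
    simp
  have hanti : AntitoneOn (fun t => mgf F μ t * Real.exp (-(t * m + t ^ 2 / 2))) (Set.Ici 0) := by
    refine antitoneOn_of_deriv_nonpos (convex_Ici _)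
      (fun s _ => (hg s).continuousAt.continuousWithinAt)
      (fun s _ => (hg s).differentiableAt.differentiableWithinAt) fun s hs => ?_
    rw [interior_Ici] at hs
    rw [(hg s).deriv]
    have h1 : _ ≤ (m + s) * mgf F μ s := integral_mul_exp_le hF hL (le_of_lt hs)
    have h2 := mul_le_mul_of_nonneg_right h1 (Real.exp_pos (-(s * m + s ^ 2 / 2))).le
    linarith
  have := hanti (Set.self_mem_Ici) (Set.mem_Ici.2 hθ) hθ
  simp only [mgf_zero, zero_mul, ne_eq, OfNat.ofNat_ne_zero, not_false_eq_true, zero_pow,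
    zero_div, add_zero, neg_zero, Real.exp_zero, mul_one] at this
  rw [Real.exp_neg, ← div_eq_mul_inv, div_le_one (Real.exp_pos _)] at this
  exact this

/-- Gaussian concentration: lower tail of a `1`-Lipschitz function. -/
lemma stdGaussian_real_lt_le (hF : ContDiff ℝ 1 F) (hL : ∀ x, ‖fderiv ℝ F x‖ ≤ 1) {t : ℝ}
    (ht : 0 ≤ t) :
    (stdGaussian E).real {x | F x ≤ ∫ y, F y ∂stdGaussian E - t} ≤ Real.exp (-t ^ 2 / 2) := by
  have hL' : ∀ x, ‖fderiv ℝ (fun x => -F x) x‖ ≤ 1 := fun x => by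
    rw [fderiv_fun_neg, norm_neg]; exact hL x
  -- Chernoff bound for `-F`; the optimal parameter for deviation `t` is `t` itself.
  have h1 := measure_ge_le_exp_mul_mgf (μ := stdGaussian E) (X := fun x => -F x)
    (-(∫ y, F y ∂stdGaussian E) + t) ht (integrable_exp_mul_of_fderiv_le hF.neg hL' t)
  have h2 := integral_exp_mul_le hF.neg hL' ht
  rw [integral_neg] at h2
  have hset : {x | F x ≤ ∫ y, F y ∂stdGaussian E - t}
      = {x | -(∫ y, F y ∂stdGaussian E) + t ≤ -F x} := by
    ext x; simp only [Set.mem_ofPred_eq]; constructor <;> intro h <;> linarith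
  rw [hset]
  refine h1.trans ((mul_le_mul_of_nonneg_left h2 (Real.exp_pos _).le).trans ?_)
  rw [← Real.exp_add]
  apply Real.exp_le_exp.2
  nlinarith

end Concentration

/-! ### A smooth min-max over finite index sets. -/

section SoftMinMax

variable {U V : Type*} [Fintype U] [Fintype V]

/-- The sums `∑ u, exp (b * x v u)`. -/
noncomputable def expSum (b : ℝ) (x : V → U → ℝ) (v : V) : ℝ := ∑ u, Real.exp (b * x v u)

/-- The sum of the inverses of the `expSum`s. -/
noncomputable def invExpSum (b : ℝ) (x : V → U → ℝ) : ℝ := ∑ v, (expSum b x v)⁻¹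

/-- A smooth approximation of `min_v max_u x v u`. -/
noncomputable def softMinMax (b : ℝ) (x : V → U → ℝ) : ℝ := -(1 / b) * Real.log (invExpSum b x)

/-- The partial derivatives of `softMinMax`. -/
noncomputable def softWeight (b : ℝ) (x : V → U → ℝ) (v : V) (u : U) : ℝ :=
  Real.exp (b * x v u) * (expSum b x v)⁻¹ * (expSum b x v)⁻¹ * (invExpSum b x)⁻¹

variable [Nonempty U]

lemma expSum_pos (b : ℝ) (x : V → U → ℝ) (v : V) : 0 < expSum b x v :=
  Finset.sum_pos (fun _ _ => Real.exp_pos _) Finset.univ_nonempty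

variable [Nonempty V]

lemma invExpSum_pos (b : ℝ) (x : V → U → ℝ) : 0 < invExpSum b x :=
  Finset.sum_pos (fun v _ => inv_pos.2 (expSum_pos b x v)) Finset.univ_nonempty

lemma softWeight_pos (b : ℝ) (x : V → U → ℝ) (v : V) (u : U) : 0 < softWeight b x v u := by
  have h1 := expSum_pos b x v
  have h2 := invExpSum_pos b x
  unfold softWeight
  positivity

lemma sum_softWeight_row (b : ℝ) (x : V → U → ℝ) (v : V) :
    ∑ u, softWeight b x v u = (expSum b x v)⁻¹ * (invExpSum b x)⁻¹ := by
  simp only [softWeight, ← Finset.sum_mul]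
  rw [← expSum, mul_inv_cancel₀ (expSum_pos b x v).ne', one_mul]

lemma sum_softWeight (b : ℝ) (x : V → U → ℝ) : ∑ v, ∑ u, softWeight b x v u = 1 := by
  simp only [sum_softWeight_row, ← Finset.sum_mul]
  rw [← invExpSum, mul_inv_cancel₀ (invExpSum_pos b x).ne']

lemma softWeight_le_one (b : ℝ) (x : V → U → ℝ) (v : V) (u : U) : softWeight b x v u ≤ 1 := by
  rw [← sum_softWeight b x]
  refine le_trans ?_ (Finset.single_le_sum (f := fun v => ∑ u, softWeight b x v u)
    (fun v _ => Finset.sum_nonneg fun u _ => (softWeight_pos b x v u).le) (Finset.mem_univ v))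
  exact Finset.single_le_sum (f := fun u => softWeight b x v u)
    (fun u _ => (softWeight_pos b x v u).le) (Finset.mem_univ u)

lemma hasDerivAt_expSum {b : ℝ} {x : ℝ → V → U → ℝ} {d : V → U → ℝ} {t : ℝ}
    (hx : ∀ v u, HasDerivAt (fun t => x t v u) (d v u) t) (v : V) :
    HasDerivAt (fun t => expSum b (x t) v) (∑ u, Real.exp (b * x t v u) * (b * d v u)) t := by
  unfold expSum
  exact HasDerivAt.fun_sum fun u _ => ((hx v u).const_mul b).exp

lemma hasDerivAt_invExpSum {b : ℝ} {x : ℝ → V → U → ℝ} {d : V → U → ℝ} {t : ℝ}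
    (hx : ∀ v u, HasDerivAt (fun t => x t v u) (d v u) t) :
    HasDerivAt (fun t => invExpSum b (x t))
      (-(b * invExpSum b (x t) * ∑ v, ∑ u, softWeight b (x t) v u * d v u)) t := by
  have h := HasDerivAt.fun_sum (u := (Finset.univ : Finset V)) fun v _ =>
    (hasDerivAt_expSum (b := b) hx v).fun_inv (expSum_pos b (x t) v).ne'
  convert! h using 1
  rw [Finset.mul_sum, ← Finset.sum_neg_distrib]
  refine Finset.sum_congr rfl fun v _ => ?_
  rw [Finset.mul_sum, neg_div, Finset.sum_div]
  congr 1
  refine Finset.sum_congr rfl fun u _ => ?_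
  have h1 := (expSum_pos b (x t) v).ne'
  have h2 := (invExpSum_pos b (x t)).ne'
  unfold softWeight
  field_simp

lemma hasDerivAt_softMinMax {b : ℝ} (hb : 0 < b) {x : ℝ → V → U → ℝ} {d : V → U → ℝ} {t : ℝ}
    (hx : ∀ v u, HasDerivAt (fun t => x t v u) (d v u) t) :
    HasDerivAt (fun t => softMinMax b (x t)) (∑ v, ∑ u, softWeight b (x t) v u * d v u) t := by
  have h2 := (invExpSum_pos b (x t)).ne'
  convert! ((hasDerivAt_invExpSum (b := b) hx).log h2).const_mul (-(1 / b)) using 1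
  field_simp

/-- The derivative of a weight of the `v`-th row in a direction vanishing on that row. -/
lemma hasDerivAt_softWeight {b : ℝ} {x : ℝ → V → U → ℝ} {d : V → U → ℝ} {t : ℝ}
    (hx : ∀ v u, HasDerivAt (fun t => x t v u) (d v u) t) {v : V} (hv : ∀ u, d v u = 0) (u : U) :
    HasDerivAt (fun t => softWeight b (x t) v u)
      (softWeight b (x t) v u * (b * ∑ v, ∑ u, softWeight b (x t) v u * d v u)) t := by
  have h1 := (expSum_pos b (x t) v).ne'
  have h2 := (invExpSum_pos b (x t)).ne'
  have e := ((hx v u).const_mul b).exp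
  have s := (hasDerivAt_expSum (b := b) hx v).fun_inv h1
  have w := (hasDerivAt_invExpSum (b := b) hx).fun_inv h2
  -- A direction vanishing on row `v` fixes the exponential and the `expSum` of that row. Only the
  -- inverse of `invExpSum` moves, so the derivative is nonnegative when `d` is, for `b ≥ 0`.
  simp only [hv, mul_zero, Finset.sum_const_zero, neg_zero, zero_div] at e s
  convert! ((e.mul s).mul s).mul w using 1
  generalize ∑ v, ∑ u, softWeight b (x t) v u * d v u = D
  unfold softWeight
  simp only [Pi.mul_apply]
  field_simp
  simp

lemma softMinMax_mono {b : ℝ} (hb : 0 < b) {x y : V → U → ℝ} (h : ∀ v u, x v u ≤ y v u) :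
    softMinMax b x ≤ softMinMax b y := by
  unfold softMinMax
  rw [neg_mul, neg_mul, neg_le_neg_iff]
  refine mul_le_mul_of_nonneg_left (Real.log_le_log (invExpSum_pos b y) ?_) (by positivity)
  refine Finset.sum_le_sum fun v _ => inv_anti₀ (expSum_pos b x v) ?_
  exact Finset.sum_le_sum fun u _ => Real.exp_le_exp.2 (mul_le_mul_of_nonneg_left (h v u) hb.le)

lemma softMinMax_add_const {b : ℝ} (hb : 0 < b) (x : V → U → ℝ) (c : ℝ) :
    softMinMax b (fun v u => x v u + c) = softMinMax b x + c := by
  have h1 : ∀ v, expSum b (fun v u => x v u + c) v = Real.exp (b * c) * expSum b x v := by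
    intro v
    simp only [expSum, Finset.mul_sum, ← Real.exp_add]
    exact Finset.sum_congr rfl fun u _ => by ring_nf
  have h2 : invExpSum b (fun v u => x v u + c) = Real.exp (-(b * c)) * invExpSum b x := by
    simp only [invExpSum, h1, mul_inv, Finset.mul_sum, Real.exp_neg]
  rw [softMinMax, h2, Real.log_mul (Real.exp_pos _).ne' (invExpSum_pos b x).ne', Real.log_exp,
    softMinMax]
  field_simp
  ring

/-- A monotone function commuting with the addition of constants is `1`-Lipschitz for the sup norm.
-/
lemma abs_softMinMax_sub_le {b : ℝ} (hb : 0 < b) {x y : V → U → ℝ} {c : ℝ}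
    (h : ∀ v u, |x v u - y v u| ≤ c) : |softMinMax b x - softMinMax b y| ≤ c := by
  have h1 : softMinMax b x ≤ softMinMax b y + c := by
    rw [← softMinMax_add_const hb]
    exact softMinMax_mono hb fun v u => by linarith [(abs_le.1 (h v u)).2]
  have h2 : softMinMax b y ≤ softMinMax b x + c := by
    rw [← softMinMax_add_const hb]
    exact softMinMax_mono hb fun v u => by linarith [(abs_le.1 (h v u)).1]
  exact abs_le.2 ⟨by linarith, by linarith⟩

/-- Every `expSum` is at least `exp (b m)`, so the sum of the `card V` inverses is at most `card V *
exp (-b m)`. This and `softMinMax_le` bound the smoothing error, which vanishes as `b → ∞`. -/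
lemma le_softMinMax {b : ℝ} (hb : 0 < b) {x : V → U → ℝ} {m : ℝ} (h : ∀ v, ∃ u, m ≤ x v u) :
    m - Real.log (Fintype.card V) / b ≤ softMinMax b x := by
  have h1 : ∀ v, (expSum b x v)⁻¹ ≤ Real.exp (-(b * m)) := by
    intro v
    obtain ⟨u, hu⟩ := h v
    rw [Real.exp_neg]
    refine inv_anti₀ (Real.exp_pos _) ?_
    refine le_trans (Real.exp_le_exp.2 (mul_le_mul_of_nonneg_left hu hb.le)) ?_
    exact Finset.single_le_sum (f := fun u => Real.exp (b * x v u))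
      (fun u _ => (Real.exp_pos _).le) (Finset.mem_univ u)
  have h2 : invExpSum b x ≤ Fintype.card V * Real.exp (-(b * m)) := by
    refine (Finset.sum_le_sum fun v _ => h1 v).trans ?_
    simp
  have hc : (0 : ℝ) < Fintype.card V := by exact_mod_cast Fintype.card_pos
  have h3 := Real.log_le_log (invExpSum_pos b x) h2
  rw [Real.log_mul hc.ne' (Real.exp_pos _).ne', Real.log_exp] at h3
  have h4 := mul_le_mul_of_nonneg_left h3 (by positivity : (0 : ℝ) ≤ 1 / b)
  have h5 : 1 / b * (Real.log (Fintype.card V) + -(b * m)) = Real.log (Fintype.card V) / b - m := by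
    field_simp; ring
  rw [softMinMax]
  linarith

lemma softMinMax_le {b : ℝ} (hb : 0 < b) {x : V → U → ℝ} {m : ℝ} {v : V} (h : ∀ u, x v u ≤ m) :
    softMinMax b x ≤ m + Real.log (Fintype.card U) / b := by
  have hc : (0 : ℝ) < Fintype.card U := by exact_mod_cast Fintype.card_pos
  have h1 : expSum b x v ≤ Fintype.card U * Real.exp (b * m) := by
    refine (Finset.sum_le_sum fun u _ =>
      Real.exp_le_exp.2 (mul_le_mul_of_nonneg_left (h u) hb.le)).trans ?_
    simp
  have h2 : (Fintype.card U * Real.exp (b * m))⁻¹ ≤ invExpSum b x :=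
    (inv_anti₀ (expSum_pos b x v) h1).trans (Finset.single_le_sum
      (f := fun v => (expSum b x v)⁻¹) (fun v _ => (inv_pos.2 (expSum_pos b x v)).le)
      (Finset.mem_univ v))
  have h3 := Real.log_le_log (by positivity) h2
  rw [Real.log_inv, Real.log_mul hc.ne' (Real.exp_pos _).ne', Real.log_exp] at h3
  have h4 := mul_le_mul_of_nonneg_left h3 (by positivity : (0 : ℝ) ≤ 1 / b)
  have h5 : 1 / b * -(Real.log (Fintype.card U) + b * m)
      = -(m + Real.log (Fintype.card U) / b) := by
    field_simp; ring
  rw [softMinMax]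
  linarith

lemma continuous_softWeight (b : ℝ) (v : V) (u : U) :
    Continuous fun x : V → U → ℝ => softWeight b x v u := by
  have h1 : ∀ v, Continuous fun x : V → U → ℝ => expSum b x v := fun v => by
    unfold expSum; fun_prop
  have h2 : ∀ v, Continuous fun x : V → U → ℝ => (expSum b x v)⁻¹ := fun v =>
    (h1 v).inv₀ fun x => (expSum_pos b x v).ne'
  have h3 : Continuous fun x : V → U → ℝ => (invExpSum b x)⁻¹ := by
    refine Continuous.inv₀ ?_ fun x => (invExpSum_pos b x).ne'
    unfold invExpSum
    exact continuous_finsetSum _ fun v _ => h2 v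
  unfold softWeight
  exact (((by fun_prop : Continuous fun x : V → U → ℝ => Real.exp (b * x v u)).mul (h2 v)).mul
    (h2 v)).mul h3

lemma contDiff_softMinMax (b : ℝ) : ContDiff ℝ 1 fun x : V → U → ℝ => softMinMax b x := by
  have h1 : ∀ v, ContDiff ℝ 1 fun x : V → U → ℝ => expSum b x v := fun v => by
    unfold expSum; fun_prop
  have h2 : ∀ v, ContDiff ℝ 1 fun x : V → U → ℝ => (expSum b x v)⁻¹ := fun v =>
    (h1 v).inv fun x => (expSum_pos b x v).ne'
  have h3 : ContDiff ℝ 1 fun x : V → U → ℝ => invExpSum b x := by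
    unfold invExpSum
    exact ContDiff.sum fun v _ => h2 v
  unfold softMinMax
  exact contDiff_const.mul (h3.log fun x => (invExpSum_pos b x).ne')

end SoftMinMax

/-! ### Gordon's comparison inequality. -/

section Gordon

variable {U V : Type*} [Fintype U] [Fintype V] [Nonempty U] [Nonempty V]
  {E : Type*} [NormedAddCommGroup E] [InnerProductSpace ℝ E]

lemma contDiff_softMinMax_inner (b : ℝ) (a : V → U → E) :
    ContDiff ℝ 1 fun y : E => softMinMax b fun v u => inner ℝ (a v u) y :=
  (contDiff_softMinMax b).comp
    (contDiff_pi.2 fun _ => contDiff_pi.2 fun _ => contDiff_const.inner ℝ contDiff_id)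

lemma norm_fderiv_softMinMax_inner_le {b : ℝ} (hb : 0 < b) {a : V → U → E}
    (ha : ∀ v u, ‖a v u‖ ≤ 1) (y : E) :
    ‖fderiv ℝ (fun y : E => softMinMax b fun v u => inner ℝ (a v u) y) y‖ ≤ 1 := by
  have : LipschitzWith 1 fun y : E => softMinMax b fun v u => inner ℝ (a v u) y := by
    refine LipschitzWith.of_dist_le_mul fun y z => ?_
    rw [Real.dist_eq, NNReal.coe_one, one_mul, dist_eq_norm]
    refine abs_softMinMax_sub_le hb fun v u => ?_
    rw [← inner_sub_right]
    exact (abs_real_inner_le_norm _ _).trans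
      (mul_le_of_le_one_left (norm_nonneg _) (ha v u))
  simpa using norm_fderiv_le_of_lipschitz ℝ this (x₀ := y)

variable [FiniteDimensional ℝ E] [MeasurableSpace E] [BorelSpace E]

lemma integrable_softMinMax_inner {b : ℝ} (hb : 0 < b) (a : V → U → E) :
    Integrable (fun y : E => softMinMax b fun v u => inner ℝ (a v u) y) (stdGaussian E) := by
  have hc := (contDiff_softMinMax_inner b a).continuous
  let K := ∑ v, ∑ u, ‖a v u‖
  refine ((integrable_const |softMinMax b (fun (_ : V) (_ : U) => (0 : ℝ))|).add
    ((integrable_norm_stdGaussian (E := E)).const_mul K)).mono' hc.aestronglyMeasurable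
    (Filter.Eventually.of_forall fun y => ?_)
  have h1 : |softMinMax b (fun v u => inner ℝ (a v u) y) - softMinMax b
      (fun (_ : V) (_ : U) => (0 : ℝ))| ≤ K * ‖y‖ := by
    refine abs_softMinMax_sub_le hb fun v u => ?_
    rw [sub_zero]
    refine (abs_real_inner_le_norm _ _).trans
      (mul_le_mul_of_nonneg_right ?_ (norm_nonneg _))
    refine le_trans (Finset.single_le_sum (f := fun u => ‖a v u‖) (fun _ _ => norm_nonneg _)
      (Finset.mem_univ u)) (Finset.single_le_sum (f := fun v => ∑ u, ‖a v u‖)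
      (fun _ _ => Finset.sum_nonneg fun _ _ => norm_nonneg _) (Finset.mem_univ v))
  have h2 := abs_sub_abs_le_abs_sub (softMinMax b (fun v u => inner ℝ (a v u) y))
    (softMinMax b (fun (_ : V) (_ : U) => (0 : ℝ)))
  simp only [Real.norm_eq_abs, Pi.add_apply]
  linarith

/-- The rotation path between two families of vectors. -/
noncomputable def rotPath (a b : V → U → E) (s : ℝ) (v : V) (u : U) : E :=
  Real.cos s • a v u + Real.sin s • b v u

/-- The velocity of `rotPath`. -/
noncomputable def rotPathDeriv (a b : V → U → E) (s : ℝ) (v : V) (u : U) : E :=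
  -Real.sin s • a v u + Real.cos s • b v u

lemma norm_rotPathDeriv_le (a b : V → U → E) (s : ℝ) (v : V) (u : U) :
    ‖rotPathDeriv a b s v u‖ ≤ ‖a v u‖ + ‖b v u‖ :=
  norm_cos_smul_add_sin_smul_le s _ _

/-- The covariance of the process with its velocity. Orthogonality of the two families removes the
cross terms and leaves the difference of the Gram matrices, whose sign the comparison hypotheses
prescribe. -/
lemma inner_rotPath_rotPathDeriv {a b : V → U → E}
    (hab : ∀ v u v' u', inner ℝ (a v u) (b v' u') = 0) (s : ℝ) (v : V) (u : U) (v' : V) (u' : U) :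
    inner ℝ (rotPath a b s v' u') (rotPathDeriv a b s v u) = Real.cos s * Real.sin s *
      (inner ℝ (b v' u') (b v u) - inner ℝ (a v' u') (a v u)) := by
  simp only [rotPath, rotPathDeriv, inner_add_left, inner_add_right, real_inner_smul_left,
    real_inner_smul_right, hab, real_inner_comm (a v u) (b v' u')]
  ring

lemma abs_sum_softWeight_mul_inner_le (β : ℝ) (a b : V → U → E) (s : ℝ) (x : V → U → ℝ) (y : E) :
    ‖∑ v, ∑ u, softWeight β x v u * inner ℝ (rotPathDeriv a b s v u) y‖ ≤
      (∑ v, ∑ u, (‖a v u‖ + ‖b v u‖)) * ‖y‖ := by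
  simp only [Finset.sum_mul]
  refine norm_sum_le_of_le _ fun v _ => norm_sum_le_of_le _ fun u _ => ?_
  rw [norm_mul, Real.norm_eq_abs, abs_of_pos (softWeight_pos _ _ _ _)]
  refine (mul_le_of_le_one_left (norm_nonneg _) (softWeight_le_one _ _ _ _)).trans ?_
  exact (abs_real_inner_le_norm _ _).trans
    (mul_le_mul_of_nonneg_right (norm_rotPathDeriv_le a b s v u) (norm_nonneg _))

lemma hasDerivAt_integral_softMinMax_rotPath {β : ℝ} (hβ : 0 < β) (a b : V → U → E) (s : ℝ) :
    HasDerivAt (fun s => ∫ y, softMinMax β (fun v u => inner ℝ (rotPath a b s v u) y)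
        ∂stdGaussian E)
      (∫ y, ∑ v, ∑ u, softWeight β (fun v u => inner ℝ (rotPath a b s v u) y) v u *
        inner ℝ (rotPathDeriv a b s v u) y ∂stdGaussian E) s := by
  refine (hasDerivAt_integral_of_dominated_loc_of_deriv_le
    (F' := fun s y => ∑ v, ∑ u, softWeight β (fun v u => inner ℝ (rotPath a b s v u) y) v u *
        inner ℝ (rotPathDeriv a b s v u) y)
    (s := Set.univ) (bound := fun y => (∑ v, ∑ u, (‖a v u‖ + ‖b v u‖)) * ‖y‖) Filter.univ_mem
    (Filter.Eventually.of_forall fun s => (integrable_softMinMax_inner hβ _).1)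
    (integrable_softMinMax_inner hβ _) ?_
    (Filter.Eventually.of_forall fun y s _ => abs_sum_softWeight_mul_inner_le β a b s _ y)
    (integrable_norm_stdGaussian.const_mul _)
    (Filter.Eventually.of_forall fun y s _ => ?_)).2
  · refine Continuous.aestronglyMeasurable ?_
    refine continuous_finsetSum _ fun v _ => continuous_finsetSum _ fun u _ => ?_
    have h1 : Continuous fun y : E => fun v u => (inner ℝ (rotPath a b s v u) y : ℝ) := by
      fun_prop
    have h2 : Continuous fun y : E => (inner ℝ (rotPathDeriv a b s v u) y : ℝ) := by fun_prop
    exact ((continuous_softWeight β v u).comp h1).mul h2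
  · refine hasDerivAt_softMinMax hβ fun v u => ?_
    have h1 : HasDerivAt (fun s => rotPath a b s v u) (rotPathDeriv a b s v u) s :=
      ((Real.hasDerivAt_cos s).smul_const (a v u)).add
        ((Real.hasDerivAt_sin s).smul_const (b v u))
    have h2 := (h1.inner ℝ (hasDerivAt_const s y))
    simpa using h2

lemma integral_sum_softWeight_nonneg {β : ℝ} (hβ : 0 < β) {a b : V → U → E}
    (hab : ∀ v u v' u', inner ℝ (a v u) (b v' u') = 0)
    (hsame : ∀ v u u', inner ℝ (a v u) (a v u') = inner ℝ (b v u) (b v u'))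
    (hle : ∀ v u v' u', inner ℝ (a v u) (a v' u') ≤ inner ℝ (b v u) (b v' u'))
    {s : ℝ} (hs : 0 ≤ Real.sin s) (hc : 0 ≤ Real.cos s) :
    0 ≤ ∫ y, ∑ v, ∑ u, softWeight β (fun v u => inner ℝ (rotPath a b s v u) y) v u *
        inner ℝ (rotPathDeriv a b s v u) y ∂stdGaussian E := by
  set x : E → V → U → ℝ := fun y v u => inner ℝ (rotPath a b s v u) y
  have hwc : ∀ v u, Continuous fun y => softWeight β (x y) v u := fun v u =>
    (continuous_softWeight β v u).comp (by fun_prop)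
  have hwi : ∀ v u, Integrable (fun y => softWeight β (x y) v u) (stdGaussian E) := fun v u => by
    refine (integrable_const (1 : ℝ)).mono' (hwc v u).aestronglyMeasurable
      (Filter.Eventually.of_forall fun y => ?_)
    rw [Real.norm_eq_abs, abs_of_pos (softWeight_pos _ _ _ _)]
    exact softWeight_le_one _ _ _ _
  have hi : ∀ v u, Integrable (fun y => inner ℝ (rotPathDeriv a b s v u) y *
      softWeight β (x y) v u) (stdGaussian E) := fun v u => by
    refine (integrable_norm_stdGaussian.const_mul ‖rotPathDeriv a b s v u‖).mono'
      ((by fun_prop : Continuous fun y => inner ℝ (rotPathDeriv a b s v u) y).mul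
        (hwc v u)).aestronglyMeasurable
      (Filter.Eventually.of_forall fun y => ?_)
    rw [norm_mul, Real.norm_eq_abs (softWeight _ _ _ _), abs_of_pos (softWeight_pos _ _ _ _)]
    exact (mul_le_of_le_one_right (norm_nonneg _) (softWeight_le_one _ _ _ _)).trans
      (abs_real_inner_le_norm _ _)
  have hi' : ∀ v u, Integrable (fun y => softWeight β (x y) v u *
      inner ℝ (rotPathDeriv a b s v u) y) (stdGaussian E) := fun v u =>
    (hi v u).congr (Filter.Eventually.of_forall fun y => mul_comm _ _)
  rw [integral_finsetSum _ fun v _ => integrable_finsetSum _ fun u _ => hi' v u]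
  refine Finset.sum_nonneg fun v _ => ?_
  rw [integral_finsetSum _ fun u _ => hi' v u]
  refine Finset.sum_nonneg fun u _ => ?_
  -- Moving `y` along the velocity of entry `(v, u)` moves the entries of `x` by `d`, which vanishes
  -- on row `v` by `hsame` and is nonnegative elsewhere by `hle`. Integration by parts then turns
  -- the summand into the mean of a nonnegative derivative of the weight.
  let d : V → U → ℝ := fun v' u' => inner ℝ (rotPath a b s v' u') (rotPathDeriv a b s v u)
  have hd : ∀ v' u', 0 ≤ d v' u' := fun v' u' => by
    simp only [d]
    rw [inner_rotPath_rotPathDeriv hab]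
    exact mul_nonneg (mul_nonneg hc hs) (sub_nonneg.2 (hle _ _ _ _))
  have hd0 : ∀ u', d v u' = 0 := fun u' => by
    simp only [d]
    rw [inner_rotPath_rotPathDeriv hab, hsame, sub_self, mul_zero]
  let h' : E → ℝ := fun y => softWeight β (x y) v u *
    (β * ∑ v', ∑ u', softWeight β (x y) v' u' * d v' u')
  have hline : ∀ y, HasLineDerivAt ℝ (fun y => softWeight β (x y) v u) (h' y) y
      (rotPathDeriv a b s v u) := by
    intro y
    have h0 : x (y + (0 : ℝ) • rotPathDeriv a b s v u) = x y := by simp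
    have := hasDerivAt_softWeight (b := β) (x := fun t => x (y + t • rotPathDeriv a b s v u))
      (d := d) (t := 0) (fun v' u' => by
        simp only [x, d, inner_add_right, real_inner_smul_right]
        simpa using ((hasDerivAt_id (0 : ℝ)).mul_const
          (inner ℝ (rotPath a b s v' u') (rotPathDeriv a b s v u))).const_add
          (inner ℝ (rotPath a b s v' u') y)) hd0 u
    simp only [h0] at this
    exact this
  have hpos : ∀ y, 0 ≤ h' y := fun y =>
    mul_nonneg (softWeight_pos _ _ _ _).le (mul_nonneg hβ.le (Finset.sum_nonneg fun v' _ =>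
      Finset.sum_nonneg fun u' _ => mul_nonneg (softWeight_pos _ _ _ _).le (hd v' u')))
  have hi3 : Integrable h' (stdGaussian E) := by
    refine (integrable_const (β * ∑ v', ∑ u', d v' u')).mono' ?_
      (Filter.Eventually.of_forall fun y => ?_)
    · exact ((hwc v u).mul (continuous_const.mul (continuous_finsetSum _ fun v' _ =>
        continuous_finsetSum _ fun u' _ => (hwc v' u').mul continuous_const))).aestronglyMeasurable
    · rw [Real.norm_eq_abs, abs_of_nonneg (hpos y)]
      refine (mul_le_of_le_one_left (mul_nonneg hβ.le (Finset.sum_nonneg fun v' _ =>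
        Finset.sum_nonneg fun u' _ => mul_nonneg (softWeight_pos _ _ _ _).le (hd v' u')))
        (softWeight_le_one _ _ _ _)).trans ?_
      refine mul_le_mul_of_nonneg_left (Finset.sum_le_sum fun v' _ => Finset.sum_le_sum
        fun u' _ => mul_le_of_le_one_left (hd v' u') (softWeight_le_one _ _ _ _)) hβ.le
  have hst := stein_identity hline (hwi v u) hi3 (hi v u)
  calc (0 : ℝ) ≤ ∫ y, h' y ∂stdGaussian E := integral_nonneg hpos
    _ = _ := hst.symm
    _ = _ := by congr 1; ext y; exact mul_comm _ _

/-- Gordon's comparison inequality for the smooth min-max of two families of Gaussian variables. -/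
theorem gordon_comparison {β : ℝ} (hβ : 0 < β) {a b : V → U → E}
    (hab : ∀ v u v' u', inner ℝ (a v u) (b v' u') = 0)
    (hsame : ∀ v u u', inner ℝ (a v u) (a v u') = inner ℝ (b v u) (b v u'))
    (hle : ∀ v u v' u', inner ℝ (a v u) (a v' u') ≤ inner ℝ (b v u) (b v' u')) :
    ∫ y, softMinMax β (fun v u => inner ℝ (a v u) y) ∂stdGaussian E ≤
      ∫ y, softMinMax β (fun v u => inner ℝ (b v u) y) ∂stdGaussian E := by
  have hmono : MonotoneOn (fun s => ∫ y, softMinMax β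
      (fun v u => inner ℝ (rotPath a b s v u) y) ∂stdGaussian E) (Set.Icc 0 (Real.pi / 2)) := by
    refine monotoneOn_of_deriv_nonneg (convex_Icc _ _)
      (fun s _ => (hasDerivAt_integral_softMinMax_rotPath hβ a b
        s).continuousAt.continuousWithinAt)
      (fun s _ => (hasDerivAt_integral_softMinMax_rotPath hβ a b
        s).differentiableAt.differentiableWithinAt) fun s hs => ?_
    rw [interior_Icc] at hs
    rw [(hasDerivAt_integral_softMinMax_rotPath hβ a b s).deriv]
    exact integral_sum_softWeight_nonneg hβ hab hsame hle
      (Real.sin_nonneg_of_nonneg_of_le_pi hs.1.le (by linarith [hs.2, Real.pi_pos]))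
      (Real.cos_nonneg_of_mem_Icc ⟨by linarith [hs.1, Real.pi_pos], hs.2.le⟩)
  have := hmono (Set.left_mem_Icc.2 (by positivity)) (Set.right_mem_Icc.2 (by positivity))
    (by positivity)
  simpa [rotPath] using this

end Gordon

/-! ### The mean norm of a Gaussian vector, compared with `√n`. -/

section ChiMean

/-- The half-line Gaussian moments. -/
noncomputable def halfMoment (k : ℕ) : ℝ :=
  ∫ y in Set.Ioi (0 : ℝ), y ^ k * Real.exp (-(1 / 2) * y ^ 2)

lemma halfMoment_eq (k : ℕ) :
    halfMoment k = (1 / 2 : ℝ) ^ (-((k : ℝ) + 1) / 2) * (1 / 2) * Real.Gamma (((k : ℝ) + 1) / 2) := by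
  rw [← integral_rpow_mul_exp_neg_mul_rpow (p := 2) (q := k) (b := 1 / 2) (by norm_num)
    (by linarith [(Nat.cast_nonneg k : (0 : ℝ) ≤ k)]) (by norm_num), halfMoment]
  simp only [Real.rpow_natCast, Real.rpow_two]

lemma halfMoment_pos (k : ℕ) : 0 < halfMoment k := by
  rw [halfMoment_eq]
  have := Real.Gamma_pos_of_pos (s := ((k : ℝ) + 1) / 2) (by positivity)
  positivity

lemma halfMoment_add_two (k : ℕ) : halfMoment (k + 2) = (k + 1) * halfMoment k := by
  rw [halfMoment_eq, halfMoment_eq]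
  have h1 : ((k + 2 : ℕ) + 1 : ℝ) / 2 = ((k : ℝ) + 1) / 2 + 1 := by push_cast; ring
  have h2 : -(((k + 2 : ℕ) : ℝ) + 1) / 2 = -((k : ℝ) + 1) / 2 - 1 := by push_cast; ring
  rw [h1, h2, Real.Gamma_add_one (by positivity), Real.rpow_sub_one (by norm_num)]
  ring

/-- The mean of the Euclidean norm of a standard Gaussian vector of dimension `n`. -/
noncomputable def chiMean (n : ℕ) : ℝ := ∫ x, ‖x‖ ∂stdGaussian (EuclideanSpace ℝ (Fin n))

/-- Polar coordinates give both sides up to a constant independent of `j`; the case `j = 0`, where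
the integral is `1`, eliminates it. -/
lemma integral_norm_pow_stdGaussian (k j : ℕ) :
    ∫ x, ‖x‖ ^ j ∂stdGaussian (EuclideanSpace ℝ (Fin (k + 1)))
      = halfMoment (k + j) / halfMoment k := by
  have key : ∀ j : ℕ, ∫ x, ‖x‖ ^ j ∂stdGaussian (EuclideanSpace ℝ (Fin (k + 1)))
      = gaussNorm (EuclideanSpace ℝ (Fin (k + 1))) * ((k + 1) * (volume.real
        (Metric.ball (0 : EuclideanSpace ℝ (Fin (k + 1))) 1) * halfMoment (k + j))) := by
    intro j
    rw [integral_stdGaussian_eq, integral_fun_norm_addHaar (volume : Measure (EuclideanSpace ℝ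
      (Fin (k + 1)))) (fun y => y ^ j * Real.exp (-(1 / 2) * y ^ 2))]
    simp only [finrank_euclideanSpace, Fintype.card_fin, Nat.add_sub_cancel, smul_eq_mul,
      nsmul_eq_mul, halfMoment, pow_add, mul_assoc]
    push_cast
    rfl
  have h0 := key 0
  simp only [pow_zero, integral_const, smul_eq_mul, mul_one, probReal_univ, add_zero] at h0
  rw [key j, eq_div_iff (halfMoment_pos k).ne']
  linear_combination (-halfMoment (k + j)) * h0

lemma chiMean_succ (k : ℕ) : chiMean (k + 1) = halfMoment (k + 1) / halfMoment k := by
  rw [← integral_norm_pow_stdGaussian k 1, chiMean]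
  simp

lemma chiMean_pos (k : ℕ) : 0 < chiMean (k + 1) := by
  rw [chiMean_succ]
  exact div_pos (halfMoment_pos _) (halfMoment_pos _)

lemma chiMean_mul_chiMean (k : ℕ) : chiMean (k + 1) * chiMean (k + 2) = k + 1 := by
  rw [chiMean_succ, chiMean_succ, halfMoment_add_two]
  have h1 := (halfMoment_pos k).ne'
  have h2 := (halfMoment_pos (k + 1)).ne'
  field_simp

lemma integral_norm_sq_stdGaussian (k : ℕ) :
    ∫ x, ‖x‖ ^ 2 ∂stdGaussian (EuclideanSpace ℝ (Fin (k + 1))) = k + 1 := by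
  rw [integral_norm_pow_stdGaussian, halfMoment_add_two, mul_div_cancel_right₀ _
    (halfMoment_pos k).ne']

lemma sq_chiMean_le (k : ℕ) : chiMean (k + 1) ^ 2 ≤ k + 1 := by
  rw [← integral_norm_sq_stdGaussian, chiMean]
  have h2 : MemLp (fun x : EuclideanSpace ℝ (Fin (k + 1)) => ‖x‖) 2
      (stdGaussian (EuclideanSpace ℝ (Fin (k + 1)))) := IsGaussian.memLp_two_id.norm
  have := variance_nonneg (fun x : EuclideanSpace ℝ (Fin (k + 1)) => ‖x‖)
    (stdGaussian (EuclideanSpace ℝ (Fin (k + 1))))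
  rw [variance_eq_sub h2] at this
  simp only [Pi.pow_apply] at this
  linarith

/-- The comparison sequence `(n - 1/2) + 1/(8n)` at `n = k + 1`. -/
noncomputable def chiLower (k : ℕ) : ℝ := (k : ℝ) + 1 / 2 + 1 / (8 * ((k : ℝ) + 1))

lemma chiLower_pos (k : ℕ) : 0 < chiLower k := by unfold chiLower; positivity

lemma chiLower_step (k : ℕ) :
    ((k : ℝ) + 2) ^ 2 * chiLower k ≤ ((k : ℝ) + 1) ^ 2 * chiLower (k + 2) := by
  have hk : (0 : ℝ) ≤ k := Nat.cast_nonneg k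
  have e : ((k : ℝ) + 1) ^ 2 * chiLower (k + 2) - ((k : ℝ) + 2) ^ 2 * chiLower k
      = (3 * k + 1) / (8 * ((k : ℝ) + 1) * (k + 3)) := by
    unfold chiLower
    push_cast
    field_simp
    ring
  have : 0 ≤ (3 * k + 1) / (8 * ((k : ℝ) + 1) * (k + 3)) := by positivity
  linarith

lemma chiMean_add_two (k : ℕ) : chiMean (k + 3) * (k + 1) = chiMean (k + 1) * (k + 2) := by
  have h1 := chiMean_mul_chiMean k
  have h2 := chiMean_mul_chiMean (k + 1)
  push_cast at h2
  have h3 := (chiMean_pos (k + 1)).ne'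
  apply mul_left_cancel₀ h3
  have e1 : k + 1 + 1 = k + 2 := rfl
  have e2 : k + 1 + 2 = k + 3 := rfl
  rw [e1, e2] at h2
  rw [e1]
  linear_combination ((k : ℝ) + 1) * h2 - ((k : ℝ) + 2) * h1

/-- The ratio of `chiMean²` to the comparison sequence decreases in steps of two, while
`ratio_chiLower_ge` bounds it below by a quantity tending to `1`. It is therefore at least `1`
everywhere, which is `chiLower_le_sq_chiMean`. -/
lemma ratio_chiLower_step (k : ℕ) :
    chiMean (k + 3) ^ 2 / chiLower (k + 2) ≤ chiMean (k + 1) ^ 2 / chiLower k := by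
  rw [div_le_div_iff₀ (chiLower_pos _) (chiLower_pos _)]
  have hk : (0 : ℝ) < (k : ℝ) + 1 := by positivity
  have h1 := chiMean_add_two k
  have h2 := mul_le_mul_of_nonneg_left (chiLower_step k) (sq_nonneg (chiMean (k + 1)))
  have h3 : chiMean (k + 3) ^ 2 * ((k : ℝ) + 1) ^ 2 = chiMean (k + 1) ^ 2 * ((k : ℝ) + 2) ^ 2 := by
    rw [← mul_pow, h1, mul_pow]
  have h4 : 0 < ((k : ℝ) + 1) ^ 2 := by positivity
  refine le_of_mul_le_mul_right ?_ h4
  calc chiMean (k + 3) ^ 2 * chiLower k * ((k : ℝ) + 1) ^ 2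
      = chiMean (k + 3) ^ 2 * ((k : ℝ) + 1) ^ 2 * chiLower k := by ring
    _ = chiMean (k + 1) ^ 2 * (((k : ℝ) + 2) ^ 2 * chiLower k) := by rw [h3]; ring
    _ ≤ _ := h2
    _ = _ := by ring

lemma ratio_chiLower_iterate (k j : ℕ) :
    chiMean (k + 2 * j + 1) ^ 2 / chiLower (k + 2 * j) ≤ chiMean (k + 1) ^ 2 / chiLower k := by
  induction j with
  | zero => simp
  | succ j ih => exact (ratio_chiLower_step (k + 2 * j)).trans ih

lemma ratio_chiLower_ge (k : ℕ) :
    1 - 2 / ((k : ℝ) + 2) ≤ chiMean (k + 1) ^ 2 / chiLower k := by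
  rw [le_div_iff₀ (chiLower_pos k)]
  have h1 := chiMean_mul_chiMean k
  have h2 := sq_chiMean_le (k + 1)
  push_cast at h2
  have hk : (0 : ℝ) ≤ k := Nat.cast_nonneg k
  have h3 : ((k : ℝ) + 1) ^ 2 ≤ chiMean (k + 1) ^ 2 * (k + 2) := by
    rw [← h1, mul_pow]
    refine mul_le_mul_of_nonneg_left ?_ (sq_nonneg _)
    calc _ ≤ _ := h2
      _ = _ := by ring
  have h4 : ((k : ℝ) + 1) ^ 2 / (k + 2) ≤ chiMean (k + 1) ^ 2 := by
    rw [div_le_iff₀ (by positivity)]; exact h3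
  refine le_trans ?_ h4
  have h5 : chiLower k ≤ (k : ℝ) + 1 := by
    unfold chiLower
    have : 1 / (8 * ((k : ℝ) + 1)) ≤ 1 / 8 := by
      apply one_div_le_one_div_of_le <;> linarith
    linarith
  have h6 : 1 - 2 / ((k : ℝ) + 2) = k / (k + 2) := by field_simp; ring
  rw [h6, div_mul_eq_mul_div]
  refine div_le_div_of_nonneg_right ?_ (by positivity)
  nlinarith

lemma chiLower_le_sq_chiMean (k : ℕ) : chiLower k ≤ chiMean (k + 1) ^ 2 := by
  rw [← one_le_div (chiLower_pos k)]
  have hlim : Filter.Tendsto (fun j : ℕ => 1 - 2 / (((k + 2 * j : ℕ) : ℝ) + 2)) Filter.atTop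
      (nhds (1 - 0)) := by
    refine tendsto_const_nhds.sub (Filter.Tendsto.div_atTop tendsto_const_nhds ?_)
    refine Filter.tendsto_atTop_add_const_right _ _ (tendsto_natCast_atTop_atTop.comp ?_)
    exact Filter.tendsto_atTop_mono (fun j => by simp only [id]; omega) Filter.tendsto_id
  rw [sub_zero] at hlim
  exact le_of_tendsto hlim (Filter.Eventually.of_forall fun j =>
    (ratio_chiLower_ge (k + 2 * j)).trans (ratio_chiLower_iterate k j))

/-- With `a = √(n + 1)` and `c = √n`, this is the squared form of the inequality needed in
`sqrt_succ_sub_sqrt_le`. It rests on `a c ≥ n + 1 / 2 - 1 / (8 n)`; the factor `1 + 4 e` more than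
repays the resulting loss `1 / (4 n)`. -/
lemma four_mul_le_sq_mul_sq {n e a c : ℝ} (hn1 : 1 ≤ n) (he : e = 1 / (8 * (n + 1)))
    (ha : a ^ 2 = n + 1) (hc : c ^ 2 = n) (ha0 : 0 < a) (hc0 : 0 < c) :
    4 * (n + 1 / 2 + e) ≤ ((1 + 2 * e) * (a + c)) ^ 2 := by
  have he0 : 0 < e := by rw [he]; positivity
  have h9 : 1 / (4 * n) ≤ 1 / 4 := one_div_le_one_div_of_le (by norm_num) (by linarith)
  have hac : n + 1 / 2 - 1 / (8 * n) ≤ a * c := by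
    refine abs_le_of_sq_le_sq' ?_ (by positivity) |>.2
    rw [mul_pow, ha, hc]
    have h1 : (n + 1) * n - (n + 1 / 2 - 1 / (8 * n)) ^ 2 = (8 * n - 1) / (64 * n ^ 2) := by
      field_simp; ring
    have h2 : 0 ≤ (8 * n - 1) / (64 * n ^ 2) := div_nonneg (by linarith) (by positivity)
    linarith
  have hsq : 4 * n + 2 - 1 / (4 * n) ≤ (a + c) ^ 2 := by
    have h1 : (a + c) ^ 2 = 2 * n + 1 + 2 * (a * c) := by linear_combination ha + hc
    have h8 : 1 / (4 * n) = 2 * (1 / (8 * n)) := by field_simp; norm_num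
    linarith
  have h10 : 1 ≤ 4 * e * (4 * n) := by
    rw [he, show 4 * (1 / (8 * (n + 1))) * (4 * n) = 2 * n / (n + 1) by field_simp; ring,
      le_div_iff₀ (by linarith)]
    linarith
  have h11 : 4 * e * (4 * n) ≤ 4 * e * (4 * n + 1 - 1 / (4 * n)) :=
    mul_le_mul_of_nonneg_left (by linarith) (by positivity)
  have h12 : (1 + 4 * e) * (4 * n + 2 - 1 / (4 * n)) ≤ (1 + 2 * e) ^ 2 * (a + c) ^ 2 := by
    refine mul_le_mul ?_ hsq (by linarith) (by positivity)
    linarith [sq_nonneg e]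
  rw [mul_pow]
  linarith

lemma sqrt_succ_sub_sqrt_le {n e : ℝ} (hn1 : 1 ≤ n) (he : e = 1 / (8 * (n + 1))) :
    √(n + 1) - √n ≤ (1 / 2 + e) / √(n + 1 / 2 + e) := by
  have he0 : 0 < e := by rw [he]; positivity
  have hL0 : 0 < n + 1 / 2 + e := by positivity
  rw [le_div_iff₀ (Real.sqrt_pos.2 hL0)]
  have ha : √(n + 1) ^ 2 = n + 1 := Real.sq_sqrt (by linarith)
  have hc : √n ^ 2 = n := Real.sq_sqrt (by linarith)
  have ha0 : 0 < √(n + 1) := Real.sqrt_pos.2 (by linarith)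
  have hc0 : 0 < √n := Real.sqrt_pos.2 (by linarith)
  have hfin := four_mul_le_sq_mul_sq hn1 he ha hc ha0 hc0
  have hroot : 2 * √(n + 1 / 2 + e) ≤ (1 + 2 * e) * (√(n + 1) + √n) := by
    refine abs_le_of_sq_le_sq' ?_ (by positivity) |>.2
    rw [mul_pow 2, Real.sq_sqrt hL0.le]
    linarith
  have hdiff : (√(n + 1) - √n) * (√(n + 1) + √n) = 1 := by linear_combination ha - hc
  have hac0 : 0 ≤ √(n + 1) - √n := sub_nonneg.2 (Real.sqrt_le_sqrt (by linarith))
  have h1 := mul_le_mul_of_nonneg_left hroot hac0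
  have h2 : (√(n + 1) - √n) * ((1 + 2 * e) * (√(n + 1) + √n)) = 1 + 2 * e := by
    linear_combination (1 + 2 * e) * hdiff
  linarith

/-- The function `w - n / w` increases with `w`, so it is bounded below by its value at `√(n + 1 / 2
+ e)`. For `w = chiMean (n + 1)` it is the increment of `chiMean`, because consecutive means have
product `n`. -/
lemma div_sqrt_le_sub_div {n e w : ℝ} (hn : 0 ≤ n) (hw : 0 < w) (hL0 : 0 < n + 1 / 2 + e)
    (hL : n + 1 / 2 + e ≤ w ^ 2) : (1 / 2 + e) / √(n + 1 / 2 + e) ≤ w - n / w := by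
  have hsL0 : 0 < √(n + 1 / 2 + e) := Real.sqrt_pos.2 hL0
  have hsL : √(n + 1 / 2 + e) ≤ w := (Real.sqrt_le_left hw.le).2 hL
  have h1 : n / w ≤ n / √(n + 1 / 2 + e) := div_le_div_of_nonneg_left hn hsL0 hsL
  have h2 : √(n + 1 / 2 + e) - n / √(n + 1 / 2 + e) = (1 / 2 + e) / √(n + 1 / 2 + e) := by
    rw [sub_eq_iff_eq_add, ← add_div, eq_div_iff hsL0.ne', Real.mul_self_sqrt hL0.le]
    ring
  linarith

lemma sqrt_sub_le_chiMean_sub (k : ℕ) :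
    √((k : ℝ) + 1 + 1) - √((k : ℝ) + 1) ≤ chiMean (k + 2) - chiMean (k + 1) := by
  have hk : (0 : ℝ) ≤ k := Nat.cast_nonneg k
  have hw0 : 0 < chiMean (k + 2) := chiMean_pos (k + 1)
  have hm : chiMean (k + 1) = ((k : ℝ) + 1) / chiMean (k + 2) := by
    rw [eq_div_iff hw0.ne']; exact chiMean_mul_chiMean k
  rw [hm]
  refine (sqrt_succ_sub_sqrt_le (by linarith) rfl).trans
    (div_sqrt_le_sub_div (by positivity) hw0 (by positivity) ?_)
  refine le_trans (le_of_eq ?_) (chiLower_le_sq_chiMean (k + 1))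
  simp only [chiLower]
  push_cast
  ring

/-- `√n - chiMean n` is nonincreasing. -/
lemma sqrt_sub_sqrt_le_chiMean_sub {p n : ℕ} (hp : 0 < p) (hpn : p ≤ n) :
    √(n : ℝ) - √(p : ℝ) ≤ chiMean n - chiMean p := by
  induction n, hpn using Nat.le_induction with
  | base => simp
  | succ n hn ih =>
    obtain ⟨k, rfl⟩ : ∃ k, n = k + 1 := ⟨n - 1, by omega⟩
    have := sqrt_sub_le_chiMean_sub k
    push_cast at ih ⊢
    linarith

end ChiMean

/-! ### Gaussian vectors on a product space. -/

section Product

variable {A B : Type*} [NormedAddCommGroup A] [InnerProductSpace ℝ A] [FiniteDimensional ℝ A]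
  [MeasurableSpace A] [BorelSpace A] [NormedAddCommGroup B] [InnerProductSpace ℝ B]
  [FiniteDimensional ℝ B] [MeasurableSpace B] [BorelSpace B]

lemma stdGaussian_map_fst :
    (stdGaussian (WithLp 2 (A × B))).map (fun x => x.fst) = stdGaussian A := by
  refine stdGaussian_map_of_adjoint_norm (WithLp.fstL 2 ℝ A B) (fun y => WithLp.toLp 2 (y, 0))
    (fun x y => ?_) fun y => ?_
  · simp [WithLp.prod_inner_apply]
  · rw [WithLp.prod_norm_eq_of_L2]; simp

lemma stdGaussian_map_snd :
    (stdGaussian (WithLp 2 (A × B))).map (fun x => x.snd) = stdGaussian B := by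
  refine stdGaussian_map_of_adjoint_norm (WithLp.sndL 2 ℝ A B) (fun y => WithLp.toLp 2 (0, y))
    (fun x y => ?_) fun y => ?_
  · simp [WithLp.prod_inner_apply]
  · rw [WithLp.prod_norm_eq_of_L2]; simp

lemma measurable_fst_withLp : Measurable fun x : WithLp 2 (A × B) => x.fst :=
  (WithLp.fstL 2 ℝ A B).continuous.measurable

lemma measurable_snd_withLp : Measurable fun x : WithLp 2 (A × B) => x.snd :=
  (WithLp.sndL 2 ℝ A B).continuous.measurable

lemma integral_fst_stdGaussian {f : A → ℝ} (hf : Continuous f) :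
    ∫ x : WithLp 2 (A × B), f x.fst ∂stdGaussian (WithLp 2 (A × B)) = ∫ x, f x ∂stdGaussian A := by
  rw [← stdGaussian_map_fst (A := A) (B := B), integral_map measurable_fst_withLp.aemeasurable
    (by fun_prop)]

lemma integral_snd_stdGaussian {f : B → ℝ} (hf : Continuous f) :
    ∫ x : WithLp 2 (A × B), f x.snd ∂stdGaussian (WithLp 2 (A × B)) = ∫ x, f x ∂stdGaussian B := by
  rw [← stdGaussian_map_snd (A := A) (B := B), integral_map measurable_snd_withLp.aemeasurable
    (by fun_prop)]

lemma integrable_fst_stdGaussian {f : A → ℝ} (hf : Integrable f (stdGaussian A)) :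
    Integrable (fun x : WithLp 2 (A × B) => f x.fst) (stdGaussian (WithLp 2 (A × B))) := by
  rw [← stdGaussian_map_fst (A := A) (B := B)] at hf
  exact hf.comp_measurable measurable_fst_withLp

lemma integrable_snd_stdGaussian {f : B → ℝ} (hf : Integrable f (stdGaussian B)) :
    Integrable (fun x : WithLp 2 (A × B) => f x.snd) (stdGaussian (WithLp 2 (A × B))) := by
  rw [← stdGaussian_map_snd (A := A) (B := B)] at hf
  exact hf.comp_measurable measurable_snd_withLp

variable {U V : Type*} [Fintype U] [Fintype V] [Nonempty U] [Nonempty V]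

lemma inner_toLp_prod (a : A) (b : B) (y : WithLp 2 (A × B)) :
    (inner ℝ (WithLp.toLp 2 (a, b)) y : ℝ) = inner ℝ a y.fst + inner ℝ b y.snd := rfl

/-- Gordon's comparison for families living on two different spaces. -/
theorem gordon_comparison_two {β : ℝ} (hβ : 0 < β) {a : V → U → A} {b : V → U → B}
    (hsame : ∀ v u u', (inner ℝ (a v u) (a v u') : ℝ) = inner ℝ (b v u) (b v u'))
    (hle : ∀ v u v' u', (inner ℝ (a v u) (a v' u') : ℝ) ≤ inner ℝ (b v u) (b v' u')) :
    ∫ y, softMinMax β (fun v u => inner ℝ (a v u) y) ∂stdGaussian A ≤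
      ∫ y, softMinMax β (fun v u => inner ℝ (b v u) y) ∂stdGaussian B := by
  -- Complementary factors of the product make the two families orthogonal.
  have h := gordon_comparison (E := WithLp 2 (A × B)) hβ
    (a := fun v u => WithLp.toLp 2 (a v u, 0)) (b := fun v u => WithLp.toLp 2 (0, b v u))
    (by simp [WithLp.prod_inner_apply]) (by simpa [WithLp.prod_inner_apply] using hsame)
    (by simpa [WithLp.prod_inner_apply] using hle)
  simp only [inner_toLp_prod, inner_zero_left, add_zero, zero_add] at h
  rwa [integral_fst_stdGaussian (f := fun y => softMinMax β fun v u => inner ℝ (a v u) y)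
      (contDiff_softMinMax_inner β a).continuous,
    integral_snd_stdGaussian (f := fun y => softMinMax β fun v u => inner ℝ (b v u) y)
      (contDiff_softMinMax_inner β b).continuous] at h

end Product

/-! ### The smallest singular value of a standard Gaussian matrix. -/

section SingularValue

variable {n p : ℕ}

/-- Matrices, seen as families of rows, with the Frobenius norm. -/
abbrev RowSpace (n p : ℕ) : Type := PiLp 2 fun _ : Fin n => EuclideanSpace ℝ (Fin p)

/-- The action of a family of rows on a vector. -/
noncomputable def rowMul (G : RowSpace n p) (v : EuclideanSpace ℝ (Fin p)) :
    EuclideanSpace ℝ (Fin n) := WithLp.toLp 2 fun i => inner ℝ (G i) v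

/-- The rank-one matrix `u vᵀ`. -/
noncomputable def rankOneRows (u : EuclideanSpace ℝ (Fin n)) (v : EuclideanSpace ℝ (Fin p)) :
    RowSpace n p := WithLp.toLp 2 fun i => u i • v

lemma inner_rankOneRows (u : EuclideanSpace ℝ (Fin n)) (v : EuclideanSpace ℝ (Fin p))
    (G : RowSpace n p) : (inner ℝ (rankOneRows u v) G : ℝ) = inner ℝ u (rowMul G v) := by
  simp only [rankOneRows, rowMul, PiLp.inner_apply (𝕜 := ℝ) u]
  rw [PiLp.inner_apply]
  refine Finset.sum_congr rfl fun i _ => ?_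
  rw [real_inner_comm]
  simp [real_inner_smul_right, mul_comm]

lemma inner_rankOneRows_rankOneRows (u u' : EuclideanSpace ℝ (Fin n))
    (v v' : EuclideanSpace ℝ (Fin p)) :
    (inner ℝ (rankOneRows u v) (rankOneRows u' v') : ℝ) = inner ℝ u u' * inner ℝ v v' := by
  simp only [rankOneRows, PiLp.inner_apply (𝕜 := ℝ) u u', Finset.sum_mul]
  rw [PiLp.inner_apply]
  refine Finset.sum_congr rfl fun i _ => ?_
  simp only [real_inner_smul_left, real_inner_smul_right]
  simp
  ring

lemma norm_rankOneRows (u : EuclideanSpace ℝ (Fin n)) (v : EuclideanSpace ℝ (Fin p))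
    (hu : ‖u‖ = 1) (hv : ‖v‖ = 1) : ‖rankOneRows u v‖ = 1 := by
  rw [norm_eq_sqrt_real_inner, inner_rankOneRows_rankOneRows, real_inner_self_eq_norm_sq,
    real_inner_self_eq_norm_sq, hu, hv]
  simp

lemma continuous_rowMul (v : EuclideanSpace ℝ (Fin p)) :
    Continuous fun G : RowSpace n p => rowMul G v := by
  unfold rowMul
  fun_prop

lemma continuous_rowMul_right (G : RowSpace n p) : Continuous fun v => rowMul G v := by
  unfold rowMul
  fun_prop

variable {U V : Type*} [Fintype U] [Fintype V] [Nonempty U] [Nonempty V]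

/-- Gordon's inequality compares `⟨u, g⟩ + ⟨v, h⟩` with `⟨u, G v⟩ + γ`, where `γ` is an independent
scalar Gaussian. The covariances differ by `(1 - ⟨u, u'⟩) (1 - ⟨v, v'⟩)`, nonnegative and zero for
`v = v'`; `γ` is there to produce this product. It commutes with the min-max and has mean zero, so
it disappears. -/
lemma integral_softMinMax_rowMul_ge {β ε : ℝ} (hβ : 0 < β)
    {u : U → EuclideanSpace ℝ (Fin n)} {v : V → EuclideanSpace ℝ (Fin p)}
    (hu : ∀ i, ‖u i‖ = 1) (hv : ∀ i, ‖v i‖ = 1)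
    (hnet : ∀ g : EuclideanSpace ℝ (Fin n), ∃ i, (1 - ε) * ‖g‖ ≤ inner ℝ (u i) g) :
    (1 - ε) * chiMean n - chiMean p - Real.log (Fintype.card V) / β ≤
      ∫ G, softMinMax β (fun j i => inner ℝ (rankOneRows (u i) (v j)) G)
        ∂stdGaussian (RowSpace n p) := by
  have hdir : ∀ i i', (inner ℝ (u i) (u i') : ℝ) ≤ 1 := fun i i' => by
    have := real_inner_le_norm (u i) (u i')
    rwa [hu, hu, one_mul] at this
  have hdir' : ∀ i i', (inner ℝ (v i) (v i') : ℝ) ≤ 1 := fun i i' => by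
    have := real_inner_le_norm (v i) (v i')
    rwa [hv, hv, one_mul] at this
  have e1 : ∀ j i j' i', (inner ℝ (WithLp.toLp 2 (rankOneRows (u i) (v j), (1 : ℝ)) :
      WithLp 2 (RowSpace n p × ℝ)) (WithLp.toLp 2 (rankOneRows (u i') (v j'), (1 : ℝ))) : ℝ)
      = inner ℝ (u i) (u i') * inner ℝ (v j) (v j') + 1 := fun j i j' i' =>
    (inner_toLp_prod _ _ _).trans (congrArg₂ (· + ·) (inner_rankOneRows_rankOneRows _ _ _ _)
      (by simp))
  have e2 : ∀ j i j' i', (inner ℝ (WithLp.toLp 2 (u i, v j) :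
      WithLp 2 (EuclideanSpace ℝ (Fin n) × EuclideanSpace ℝ (Fin p)))
      (WithLp.toLp 2 (u i', v j')) : ℝ) = inner ℝ (u i) (u i') + inner ℝ (v j) (v j') :=
    fun j i j' i' => inner_toLp_prod _ _ _
  have hG := gordon_comparison_two hβ
    (a := fun j i => (WithLp.toLp 2 (u i, v j) :
      WithLp 2 (EuclideanSpace ℝ (Fin n) × EuclideanSpace ℝ (Fin p))))
    (b := fun j i => (WithLp.toLp 2 (rankOneRows (u i) (v j), (1 : ℝ)) :
      WithLp 2 (RowSpace n p × ℝ)))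
    (fun j i i' => by
      refine (e2 j i j i').trans (Eq.trans ?_ (e1 j i j i').symm)
      rw [real_inner_self_eq_norm_sq, hv]
      ring)
    (fun j i j' i' => by
      refine (e2 j i j' i').le.trans (le_trans ?_ (e1 j i j' i').ge)
      have := mul_nonneg (sub_nonneg.2 (hdir i i')) (sub_nonneg.2 (hdir' j j'))
      linarith)
  have hB : ∫ y : WithLp 2 (RowSpace n p × ℝ), softMinMax β (fun j i => inner ℝ
      (WithLp.toLp 2 (rankOneRows (u i) (v j), (1 : ℝ)) : WithLp 2 (RowSpace n p × ℝ)) y) ∂stdGaussian (WithLp 2 (RowSpace n p × ℝ))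
      = ∫ G, softMinMax β (fun j i => inner ℝ (rankOneRows (u i) (v j)) G)
        ∂stdGaussian (RowSpace n p) := by
    have h1 : ∀ y : WithLp 2 (RowSpace n p × ℝ), softMinMax β (fun j i => inner ℝ
        (WithLp.toLp 2 (rankOneRows (u i) (v j), (1 : ℝ)) : WithLp 2 (RowSpace n p × ℝ)) y)
        = softMinMax β (fun j i => inner ℝ (rankOneRows (u i) (v j)) y.fst) + y.snd := by
      intro y
      rw [← softMinMax_add_const hβ]
      simp
    simp_rw [h1]
    rw [integral_add (integrable_fst_stdGaussian (integrable_softMinMax_inner hβ _))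
      (integrable_snd_stdGaussian (f := fun x : ℝ => x) IsGaussian.integrable_fun_id),
      integral_fst_stdGaussian (f := fun y => softMinMax β fun j i => inner ℝ
        (rankOneRows (u i) (v j)) y) (contDiff_softMinMax_inner β _).continuous,
      integral_snd_stdGaussian (f := fun x : ℝ => x) continuous_id]
    simp
  rw [hB] at hG
  refine le_trans ?_ hG
  have i1 := integrable_fst_stdGaussian (B := EuclideanSpace ℝ (Fin p))
    (integrable_norm_stdGaussian (E := EuclideanSpace ℝ (Fin n)))
  have i2 := integrable_snd_stdGaussian (A := EuclideanSpace ℝ (Fin n))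
    (integrable_norm_stdGaussian (E := EuclideanSpace ℝ (Fin p)))
  have hlow : (1 - ε) * chiMean n - chiMean p - Real.log (Fintype.card V) / β
      = ∫ y : WithLp 2 (EuclideanSpace ℝ (Fin n) × EuclideanSpace ℝ (Fin p)), ((1 - ε) * ‖y.fst‖ - ‖y.snd‖ - Real.log (Fintype.card V) / β)
        ∂stdGaussian (WithLp 2 (EuclideanSpace ℝ (Fin n) × EuclideanSpace ℝ (Fin p))) := by
    have i3 := (i1.const_mul (1 - ε)).sub i2
    simp only [Pi.sub_def] at i3
    rw [integral_sub i3 (integrable_const _), integral_sub (i1.const_mul _) i2,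
      integral_const_mul,
      integral_fst_stdGaussian (f := fun x => ‖x‖) continuous_norm,
      integral_snd_stdGaussian (f := fun x => ‖x‖) continuous_norm]
    simp [chiMean]
  rw [hlow]
  refine integral_mono (((i1.const_mul _).sub i2).sub (integrable_const _))
    (integrable_softMinMax_inner hβ _) fun y => ?_
  refine le_softMinMax hβ fun j => ?_
  obtain ⟨i, hi⟩ := hnet y.fst
  refine ⟨i, ?_⟩
  have h2 := (abs_le.1 (abs_real_inner_le_norm (v j) y.snd)).1
  rw [hv, one_mul] at h2
  simp only [inner_toLp_prod]
  linarith

/-- A finite family of unit vectors almost attaining the norm. -/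
lemma exists_finite_norming (hn : 0 < n) {ε : ℝ} (hε : 0 < ε) :
    ∃ t : Set (EuclideanSpace ℝ (Fin n)), t.Finite ∧ t.Nonempty ∧ (∀ u ∈ t, ‖u‖ = 1) ∧
      ∀ g : EuclideanSpace ℝ (Fin n), ∃ u ∈ t, (1 - ε) * ‖g‖ ≤ inner ℝ u g := by
  have : Nonempty (Fin n) := ⟨⟨0, hn⟩⟩
  obtain ⟨t, ht, hfin, hcov⟩ := (isCompact_sphere (0 : EuclideanSpace ℝ (Fin n)) 1).finite_cover_balls
    hε
  obtain ⟨e, he⟩ := (NormedSpace.sphere_nonempty (x := (0 : EuclideanSpace ℝ (Fin n)))).2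
    (zero_le_one' ℝ)
  have hne : t.Nonempty := by
    obtain ⟨u, hu, -⟩ := Set.mem_iUnion₂.1 (hcov he)
    exact ⟨u, hu⟩
  have hunit : ∀ u ∈ t, ‖u‖ = 1 := fun u hu => mem_sphere_zero_iff_norm.1 (ht hu)
  refine ⟨t, hfin, hne, hunit, fun g => ?_⟩
  rcases eq_or_ne g 0 with rfl | hg
  · obtain ⟨u, hu⟩ := hne
    exact ⟨u, hu, by simp⟩
  have hg0 : 0 < ‖g‖ := norm_pos_iff.2 hg
  have hs : ‖g‖⁻¹ • g ∈ Metric.sphere (0 : EuclideanSpace ℝ (Fin n)) 1 := by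
    rw [mem_sphere_zero_iff_norm, norm_smul, norm_inv, norm_norm, inv_mul_cancel₀ hg0.ne']
  obtain ⟨u, hu, hd⟩ := Set.mem_iUnion₂.1 (hcov hs)
  refine ⟨u, hu, ?_⟩
  rw [Metric.mem_ball, dist_eq_norm] at hd
  have h1 : (inner ℝ u (g - ‖g‖ • u) : ℝ) = inner ℝ u g - ‖g‖ := by
    rw [inner_sub_right, real_inner_smul_right, real_inner_self_eq_norm_sq, hunit u hu]
    ring
  have h2 : ‖g - ‖g‖ • u‖ ≤ ε * ‖g‖ := by
    have : g - ‖g‖ • u = ‖g‖ • (‖g‖⁻¹ • g - u) := by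
      rw [smul_sub, smul_smul, mul_inv_cancel₀ hg0.ne', one_smul]
    rw [this, norm_smul, norm_norm, mul_comm]
    exact mul_le_mul_of_nonneg_right hd.le hg0.le
  have h3 := (abs_le.1 (abs_real_inner_le_norm u (g - ‖g‖ • u))).1
  rw [hunit u hu, one_mul, h1] at h3
  linarith

lemma chiMean_nonneg (n : ℕ) : 0 ≤ chiMean n := integral_nonneg fun _ => norm_nonneg _

lemma measure_exists_norm_rowMul_lt_finite_aux (hn : 0 < n) {v : V → EuclideanSpace ℝ (Fin p)}
    (hv : ∀ i, ‖v i‖ = 1) {c t : ℝ} (ht : 0 ≤ t) (hc : c + t < chiMean n - chiMean p) :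
    (stdGaussian (RowSpace n p)).real {G | ∃ j, ‖rowMul G (v j)‖ < c} ≤ Real.exp (-t ^ 2 / 2) := by
  -- The slack `δ` pays for two errors, half each: the net on the `u` side (through `ε`) and the
  -- smoothing of the min-max (through `β`).
  set δ := chiMean n - chiMean p - (c + t) with hδ
  have hδ0 : 0 < δ := by linarith
  have hm := chiMean_nonneg n
  set ε := δ / (2 * (chiMean n + 1)) with hε
  have hε0 : 0 < ε := by positivity
  have hεm : ε * chiMean n ≤ δ / 2 := by
    rw [hε, div_mul_eq_mul_div, div_le_div_iff₀ (by positivity) (by norm_num)]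
    nlinarith
  obtain ⟨T, hfin, hne, hunit, hnet⟩ := exists_finite_norming hn hε0
  have : Fintype T := hfin.fintype
  have : Nonempty T := hne.to_subtype
  set K := Real.log (Fintype.card V) + Real.log (Fintype.card T) with hK
  have hK0 : 0 ≤ K := add_nonneg (Real.log_natCast_nonneg _) (Real.log_natCast_nonneg _)
  -- `K + 1` instead of `K` keeps `β` positive when both index sets are singletons.
  set β := 2 * (K + 1) / δ with hβ
  have hβ0 : 0 < β := by positivity
  have hKβ : K / β ≤ δ / 2 := by
    rw [div_le_iff₀ hβ0, hβ]
    have : δ / 2 * (2 * (K + 1) / δ) = K + 1 := by field_simp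
    linarith
  have hE := integral_softMinMax_rowMul_ge (ε := ε) hβ0 (u := fun i : T => (i : EuclideanSpace ℝ
    (Fin n))) (v := v) (fun i => hunit i i.2) hv (fun g => by
      obtain ⟨w, hw, h⟩ := hnet g
      exact ⟨⟨w, hw⟩, h⟩)
  have hconc := stdGaussian_real_lt_le (contDiff_softMinMax_inner β fun j (i : T) =>
    rankOneRows (i : EuclideanSpace ℝ (Fin n)) (v j)) (norm_fderiv_softMinMax_inner_le hβ0
      fun j i => (norm_rankOneRows _ _ (hunit i i.2) (hv j)).le) ht
  refine le_trans (measureReal_mono ?_) hconc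
  rintro G ⟨j, hj⟩
  have hF := softMinMax_le hβ0 (x := fun j (i : T) => inner ℝ
    (rankOneRows (i : EuclideanSpace ℝ (Fin n)) (v j)) G) (m := c) (v := j) fun i => by
      rw [inner_rankOneRows]
      refine (real_inner_le_norm _ _).trans ?_
      rw [hunit i i.2, one_mul]
      exact hj.le
  rw [Set.mem_ofPred_eq]
  rw [hK, add_div] at hKβ
  linarith

lemma measure_exists_norm_rowMul_lt_finite (hn : 0 < n) {v : V → EuclideanSpace ℝ (Fin p)}
    (hv : ∀ i, ‖v i‖ = 1) {c t : ℝ} (ht : 0 < t) (hc : c + t ≤ chiMean n - chiMean p) :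
    (stdGaussian (RowSpace n p)).real {G | ∃ j, ‖rowMul G (v j)‖ < c} ≤ Real.exp (-t ^ 2 / 2) := by
  have hlim : Filter.Tendsto (fun s : ℝ => Real.exp (-s ^ 2 / 2)) (nhdsWithin t (Set.Iio t))
      (nhds (Real.exp (-t ^ 2 / 2))) :=
    ((by fun_prop : Continuous fun s : ℝ => Real.exp (-s ^ 2 / 2)).tendsto t).mono_left
      nhdsWithin_le_nhds
  -- Any `s < t` leaves strict slack; the bound is continuous, so `s` may increase to `t`.
  refine ge_of_tendsto hlim ?_
  filter_upwards [self_mem_nhdsWithin, mem_nhdsWithin_of_mem_nhds (Ioi_mem_nhds ht)] with s hs hs0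
  exact measure_exists_norm_rowMul_lt_finite_aux hn hv (le_of_lt hs0)
    (by have : s < t := hs; linarith)

/-- Lower tail of the smallest singular value of a standard Gaussian matrix. -/
theorem measure_exists_norm_rowMul_lt (hn : 0 < n) (hp : 0 < p) {c t : ℝ} (ht : 0 < t)
    (hc : c + t ≤ chiMean n - chiMean p) :
    stdGaussian (RowSpace n p) {G | ∃ v, ‖rowMul G v‖ < c * ‖v‖} ≤
      ENNReal.ofReal (Real.exp (-t ^ 2 / 2)) := by
  have : Nonempty (Fin p) := ⟨⟨0, hp⟩⟩
  have hne : Nonempty (Metric.sphere (0 : EuclideanSpace ℝ (Fin p)) 1) :=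
    ((NormedSpace.sphere_nonempty (x := (0 : EuclideanSpace ℝ (Fin p)))).2
      (zero_le_one' ℝ)).to_subtype
  let w : ℕ → EuclideanSpace ℝ (Fin p) := fun k =>
    (TopologicalSpace.denseSeq (Metric.sphere (0 : EuclideanSpace ℝ (Fin p)) 1) k : _)
  have hw : ∀ k, ‖w k‖ = 1 := fun k => mem_sphere_zero_iff_norm.1 (Subtype.property _)
  have hsub : {G : RowSpace n p | ∃ v, ‖rowMul G v‖ < c * ‖v‖} ⊆
      ⋃ k : ℕ, {G | ∃ j : Fin (k + 1), ‖rowMul G (w j)‖ < c} := by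
    rintro G ⟨v, hv⟩
    have hv0 : v ≠ 0 := by
      rintro rfl
      rw [norm_zero, mul_zero] at hv
      exact absurd hv (not_lt.2 (norm_nonneg _))
    have hvn : 0 < ‖v‖ := norm_pos_iff.2 hv0
    have hsm : rowMul G (‖v‖⁻¹ • v) = ‖v‖⁻¹ • rowMul G v := by
      ext i
      simp [rowMul, real_inner_smul_right]
    have hlt : ‖rowMul G (‖v‖⁻¹ • v)‖ < c := by
      rw [hsm, norm_smul, norm_inv, norm_norm, inv_mul_lt_iff₀ hvn, mul_comm]
      exact hv
    have hmem : ‖v‖⁻¹ • v ∈ Metric.sphere (0 : EuclideanSpace ℝ (Fin p)) 1 := by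
      rw [mem_sphere_zero_iff_norm, norm_smul, norm_inv, norm_norm, inv_mul_cancel₀ hvn.ne']
    have hopen : IsOpen {z : Metric.sphere (0 : EuclideanSpace ℝ (Fin p)) 1 |
        ‖rowMul G (z : EuclideanSpace ℝ (Fin p))‖ < c} :=
      isOpen_lt (((continuous_rowMul_right G).comp continuous_subtype_val).norm) continuous_const
    obtain ⟨_, hz, ⟨k, rfl⟩⟩ := (TopologicalSpace.denseRange_denseSeq
      (Metric.sphere (0 : EuclideanSpace ℝ (Fin p)) 1)).inter_open_nonempty _ hopen
      ⟨⟨_, hmem⟩, hlt⟩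
    exact Set.mem_iUnion.2 ⟨k, Fin.last k, hz⟩
  refine (measure_mono hsub).trans ?_
  -- The finite families are nested and the bound does not depend on their size, so continuity from
  -- below replaces a union bound.
  have hmono : Monotone fun k : ℕ => {G : RowSpace n p | ∃ j : Fin (k + 1),
      ‖rowMul G (w j)‖ < c} := by
    rintro k l hkl G ⟨j, hj⟩
    exact ⟨⟨j, by omega⟩, hj⟩
  rw [hmono.measure_iUnion]
  refine iSup_le fun k => ?_
  rw [← ofReal_measureReal]
  exact ENNReal.ofReal_le_ofReal
    (measure_exists_norm_rowMul_lt_finite hn (v := fun j : Fin (k + 1) => w j) (fun j => hw j) ht hc)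

end SingularValue

/-! ### Deterministic bounds: eigenvalues, least squares and recovery. -/

section LinearAlgebra

variable {n p : ℕ}

lemma minEigenvalue_mul_norm_le {A : Matrix (Fin p) (Fin p) ℝ} (hA : A.PosSemidef)
    (v : EuclideanSpace ℝ (Fin p)) :
    minEigenvalue A * ‖v‖ ≤ ‖Matrix.toEuclideanCLM (𝕜 := ℝ) A v‖ := by
  have hle : algebraMap ℝ (Matrix (Fin p) (Fin p) ℝ) (minEigenvalue A) ≤ A :=
    algebraMap_le_of_le_spectrum (fun x hx => csInf_le A.finite_real_spectrum.bddBelow hx)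
      hA.isHermitian.isSelfAdjoint
  have h1 := (Matrix.le_iff.1 hle).dotProduct_mulVec_nonneg v.ofLp
  rw [Matrix.sub_mulVec, dotProduct_sub, star_trivial, ← Matrix.inner_toEuclideanCLM,
    ← Matrix.inner_toEuclideanCLM] at h1
  have h2 : Matrix.toEuclideanCLM (𝕜 := ℝ)
      (algebraMap ℝ (Matrix (Fin p) (Fin p) ℝ) (minEigenvalue A)) v = minEigenvalue A • v := by
    rw [Algebra.algebraMap_eq_smul_one, map_smul, map_one]
    rfl
  rw [h2, real_inner_smul_right, real_inner_self_eq_norm_sq] at h1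
  have h3 := real_inner_le_norm v (Matrix.toEuclideanCLM (𝕜 := ℝ) A v)
  rcases eq_or_lt_of_le (norm_nonneg v) with h0 | h0
  · rw [← h0, mul_zero]; exact norm_nonneg _
  · refine le_of_mul_le_mul_left ?_ h0
    nlinarith

lemma sqrt_posSemidef (S : Matrix (Fin p) (Fin p) ℝ) : (CFC.sqrt S).PosSemidef :=
  Matrix.nonneg_iff_posSemidef.1 (CFC.sqrt_nonneg S)

lemma inner_toEuclideanCLM_symm {A : Matrix (Fin p) (Fin p) ℝ} (hA : A.PosSemidef)
    (x y : EuclideanSpace ℝ (Fin p)) :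
    (inner ℝ (Matrix.toEuclideanCLM (𝕜 := ℝ) A x) y : ℝ)
      = inner ℝ x (Matrix.toEuclideanCLM (𝕜 := ℝ) A y) := by
  rw [real_inner_comm, Matrix.inner_toEuclideanCLM, Matrix.inner_toEuclideanCLM,
    Matrix.dotProduct_mulVec, ← Matrix.mulVec_transpose, dotProduct_comm]
  have : Aᵀ = A := by simpa using hA.isHermitian.eq
  rw [this]

/-- Test on a basis vector: `‖√S e_j‖² = S j j`, and any `j` will do. -/
lemma minEigenvalue_sqrt_le_rhoDiag (hp : 0 < p) {S : Matrix (Fin p) (Fin p) ℝ}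
    (hS : S.PosSemidef) : minEigenvalue (CFC.sqrt S) ≤ rhoDiag S := by
  rcases le_total (minEigenvalue (CFC.sqrt S)) 0 with h0 | h0
  · exact h0.trans (Real.sqrt_nonneg _)
  let j : Fin p := ⟨0, hp⟩
  have h1 := minEigenvalue_mul_norm_le (sqrt_posSemidef S) (EuclideanSpace.single j (1 : ℝ))
  rw [PiLp.norm_single, norm_one, mul_one] at h1
  have h2 : ‖Matrix.toEuclideanCLM (𝕜 := ℝ) (CFC.sqrt S) (EuclideanSpace.single j (1 : ℝ))‖ ^ 2
      = S j j := by
    rw [← real_inner_self_eq_norm_sq, inner_toEuclideanCLM_symm (sqrt_posSemidef S),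
      ← ContinuousLinearMap.comp_apply, ← ContinuousLinearMap.mul_def, ← map_mul,
      CFC.sqrt_mul_sqrt_self S hS.nonneg, Matrix.inner_toEuclideanCLM]
    simp
  refine Real.le_sqrt_of_sq_le ?_
  calc minEigenvalue (CFC.sqrt S) ^ 2 ≤ _ := pow_le_pow_left₀ h0 h1 2
    _ = S j j := h2
    _ ≤ ⨆ j, S j j := le_ciSup (f := fun j => S j j) (Set.finite_range _).bddAbove j

lemma rowMul_eq_mulVec (x : Fin n → EuclideanSpace ℝ (Fin p)) (v : EuclideanSpace ℝ (Fin p)) :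
    rowMul (WithLp.toLp 2 x) v = WithLp.toLp 2 (dataMatrix x *ᵥ v.ofLp) := by
  ext i
  simp [rowMul, dataMatrix, Matrix.mulVec, dotProduct, PiLp.inner_apply, mul_comm]

lemma norm_sq_rowMul (x : Fin n → EuclideanSpace ℝ (Fin p)) (v : EuclideanSpace ℝ (Fin p)) :
    ‖rowMul (WithLp.toLp 2 x) v‖ ^ 2
      = v.ofLp ⬝ᵥ (((dataMatrix x)ᵀ * dataMatrix x) *ᵥ v.ofLp) := by
  rw [rowMul_eq_mulVec, EuclideanSpace.real_norm_sq_eq, ← Matrix.mulVec_mulVec,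
    Matrix.dotProduct_mulVec, Matrix.vecMul_transpose]
  simp [dotProduct, sq]

/-- The `j`-th row of `(Xᵀ X)⁻¹ Xᵀ`. -/
noncomputable def olsRow (X : Matrix (Fin n) (Fin p) ℝ) (j : Fin p) :
    EuclideanSpace ℝ (Fin n) := WithLp.toLp 2 fun i => ((Xᵀ * X)⁻¹ * Xᵀ) j i

variable {x : Fin n → EuclideanSpace ℝ (Fin p)} {s : ℝ}

lemma isUnit_gram (hs : 0 < s)
    (hx : ∀ v : EuclideanSpace ℝ (Fin p), s * ‖v‖ ≤ ‖rowMul (WithLp.toLp 2 x) v‖) :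
    IsUnit ((dataMatrix x)ᵀ * dataMatrix x) := by
  rw [← Matrix.mulVec_injective_iff_isUnit]
  refine (injective_iff_map_eq_zero
    ((dataMatrix x)ᵀ * dataMatrix x).mulVecLin).2 fun v hv => ?_
  have h1 := norm_sq_rowMul x (WithLp.toLp 2 v)
  have hv' : ((dataMatrix x)ᵀ * dataMatrix x) *ᵥ v = 0 := hv
  rw [hv', dotProduct_zero] at h1
  have h2 := hx (WithLp.toLp 2 v)
  rw [pow_eq_zero_iff two_ne_zero] at h1
  rw [h1] at h2
  have h3 : ‖(WithLp.toLp 2 v : EuclideanSpace ℝ (Fin p))‖ ≤ 0 := by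
    by_contra h
    push Not at h
    exact absurd (mul_pos hs h) (not_lt.2 h2)
  have h4 := norm_le_zero_iff.1 h3
  simpa using congrArg WithLp.ofLp h4

/-- For `w = (Xᵀ X)⁻¹ e_j` the row `r` equals `X w`, whence `‖r‖² = w j ≤ ‖w‖ ≤ ‖r‖ / s`. -/
lemma norm_olsRow_le (hs : 0 < s)
    (hx : ∀ v : EuclideanSpace ℝ (Fin p), s * ‖v‖ ≤ ‖rowMul (WithLp.toLp 2 x) v‖) (j : Fin p) :
    s * ‖olsRow (dataMatrix x) j‖ ≤ 1 := by
  have hu := isUnit_gram hs hx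
  set X := dataMatrix x with hX
  have hdet : IsUnit (Xᵀ * X).det := (Matrix.isUnit_iff_isUnit_det _).1 hu
  have hsymm : ((Xᵀ * X)⁻¹)ᵀ = (Xᵀ * X)⁻¹ := by
    rw [Matrix.transpose_nonsing_inv, Matrix.transpose_mul, Matrix.transpose_transpose]
  let w : EuclideanSpace ℝ (Fin p) := WithLp.toLp 2 ((Xᵀ * X)⁻¹ *ᵥ Pi.single j 1)
  have h1 : rowMul (WithLp.toLp 2 x) w = olsRow X j := by
    rw [rowMul_eq_mulVec]
    ext i
    have : ((Xᵀ * X)⁻¹ * Xᵀ)ᵀ = X * (Xᵀ * X)⁻¹ := by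
      rw [Matrix.transpose_mul, Matrix.transpose_transpose, hsymm]
    have h6 : X *ᵥ w.ofLp = ((Xᵀ * X)⁻¹ * Xᵀ)ᵀ.col j := by
      rw [this, ← Matrix.mulVec_single_one, ← Matrix.mulVec_mulVec]
    exact congrFun h6 i
  have h2 : ‖olsRow X j‖ ^ 2 = w j := by
    rw [← h1, norm_sq_rowMul, ← hX]
    simp only [w]
    rw [Matrix.mulVec_mulVec, Matrix.mul_nonsing_inv _ hdet, Matrix.one_mulVec]
    simp
  have h3 : w j ≤ ‖w‖ := (le_abs_self _).trans (PiLp.norm_apply_le w j)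
  have h4 := hx w
  rw [h1] at h4
  have h5 : s * ‖olsRow X j‖ ^ 2 ≤ ‖olsRow X j‖ := by
    rw [h2]
    exact (mul_le_mul_of_nonneg_left h3 hs.le).trans h4
  rcases eq_or_lt_of_le (norm_nonneg (olsRow X j)) with h0 | h0
  · rw [← h0]; simp
  · refine le_of_mul_le_mul_right ?_ h0
    nlinarith

lemma olsEstimate_response (hX : IsUnit ((dataMatrix x)ᵀ * dataMatrix x)) (β : Fin p → ℝ)
    (e : EuclideanSpace ℝ (Fin n)) (j : Fin p) :
    olsEstimate (dataMatrix x) (response (dataMatrix x) β e) j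
      = β j + inner ℝ (olsRow (dataMatrix x) j) e := by
  have hdet := (Matrix.isUnit_iff_isUnit_det _).1 hX
  have h1 : response (dataMatrix x) β e = dataMatrix x *ᵥ β + e.ofLp := rfl
  rw [olsEstimate, h1, Matrix.mulVec_add, Matrix.mulVec_add, Matrix.mulVec_mulVec,
    Matrix.mulVec_mulVec, Matrix.mul_assoc, Matrix.nonsing_inv_mul _ hdet, Matrix.one_mulVec,
    Matrix.mulVec_mulVec, Pi.add_apply]
  congr 1
  simp [olsRow, Matrix.mulVec, dotProduct, PiLp.inner_apply, mul_comm]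

lemma topIndexSetIs_of_forall_lt {b : Fin p → ℝ} {T : Finset (Fin p)}
    (h : ∀ i ∈ T, ∀ j ∉ T, |b j| < |b i|) : TopIndexSetIs T.card b T := by
  intro T'
  refine ⟨fun ⟨hcard, htop⟩ => ?_, ?_⟩
  · by_contra hne
    have hsub : ¬ T ⊆ T' := fun hs => hne (Finset.eq_of_subset_of_card_le hs hcard.le).symm
    have hsub' : ¬ T' ⊆ T := fun hs => hne (Finset.eq_of_subset_of_card_le hs hcard.ge)
    obtain ⟨i, hi, hi'⟩ := Finset.not_subset.1 hsub
    obtain ⟨j, hj, hj'⟩ := Finset.not_subset.1 hsub'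
    exact absurd (h i hi j hj') (not_lt.2 (htop j hj i hi'))
  · rintro rfl
    exact ⟨rfl, fun i hi j hj => (h i hi j hj).le⟩

lemma topIndexSetIs_coeffSupport {β b : Fin p → ℝ} {D : ℝ} (hβ : ∀ j ∈ coeffSupport β, 2 * D < |β j|)
    (hb : ∀ j, |b j - β j| ≤ D) :
    TopIndexSetIs (coeffSupport β).card b (coeffSupport β) := by
  refine topIndexSetIs_of_forall_lt fun i hi j hj => ?_
  have hj0 : β j = 0 := by
    by_contra h
    exact hj (by simp [coeffSupport, h])
  have h1 := hβ i hi
  have h2 := hb j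
  rw [hj0, sub_zero] at h2
  have h3 := hb i
  have h4 := abs_sub_abs_le_abs_sub (β i) (b i)
  rw [abs_sub_comm] at h4
  linarith

end LinearAlgebra

/-! ### Transfer from the standard Gaussian matrix to covariance `S`. -/

section Design

variable {n p : ℕ}

lemma pi_stdGaussian_map_toLp :
    (Measure.pi fun _ : Fin n => stdGaussian (EuclideanSpace ℝ (Fin p))).map (WithLp.toLp 2)
      = stdGaussian (RowSpace n p) := by
  have : IsProbabilityMeasure ((Measure.pi fun _ : Fin n =>
      stdGaussian (EuclideanSpace ℝ (Fin p))).map (WithLp.toLp 2)) :=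
    Measure.isProbabilityMeasure_map (by fun_prop)
  apply Measure.ext_of_charFun
  ext t
  simp_rw [charFun_pi, charFun_stdGaussian, ← Complex.exp_sum, ← Complex.ofReal_pow,
    PiLp.norm_sq_eq_of_L2]
  simp [Finset.sum_div, neg_div]

lemma isOpen_exists_norm_rowMul_lt (d : ℝ) :
    IsOpen {x : Fin n → EuclideanSpace ℝ (Fin p) |
      ∃ v, ‖rowMul (WithLp.toLp 2 x) v‖ < d * ‖v‖} := by
  have : {x : Fin n → EuclideanSpace ℝ (Fin p) | ∃ v, ‖rowMul (WithLp.toLp 2 x) v‖ < d * ‖v‖}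
      = ⋃ v, {x | ‖rowMul (WithLp.toLp 2 x) v‖ < d * ‖v‖} := by
    ext x; simp
  rw [this]
  exact isOpen_iUnion fun v => isOpen_lt
    ((continuous_rowMul v).comp (PiLp.continuous_toLp 2 _)).norm continuous_const

lemma rowMul_toEuclideanCLM {A : Matrix (Fin p) (Fin p) ℝ} (hA : A.PosSemidef)
    (z : Fin n → EuclideanSpace ℝ (Fin p)) (v : EuclideanSpace ℝ (Fin p)) :
    rowMul (WithLp.toLp 2 fun i => Matrix.toEuclideanCLM (𝕜 := ℝ) A (z i)) v
      = rowMul (WithLp.toLp 2 z) (Matrix.toEuclideanCLM (𝕜 := ℝ) A v) := by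
  ext i
  exact inner_toEuclideanCLM_symm hA (z i) v

/-- Lower tail of the smallest singular value of a Gaussian design. -/
lemma pi_multivariateGaussian_exists_norm_rowMul_lt (hn : 0 < n) (hp : 0 < p)
    (S : Matrix (Fin p) (Fin p) ℝ) {c d t : ℝ} (hc : 0 ≤ c) (ht : 0 < t)
    (hct : c + t ≤ chiMean n - chiMean p) (hd : d ≤ c * minEigenvalue (CFC.sqrt S)) :
    (Measure.pi fun _ : Fin n => multivariateGaussian (0 : EuclideanSpace ℝ (Fin p)) S)
      {x | ∃ v, ‖rowMul (WithLp.toLp 2 x) v‖ < d * ‖v‖}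
      ≤ ENNReal.ofReal (Real.exp (-t ^ 2 / 2)) := by
  have hlaw : (Measure.pi fun _ : Fin n => multivariateGaussian (0 : EuclideanSpace ℝ (Fin p)) S)
      = (Measure.pi fun _ : Fin n => stdGaussian (EuclideanSpace ℝ (Fin p))).map
        fun z i => Matrix.toEuclideanCLM (𝕜 := ℝ) (CFC.sqrt S) (z i) := by
    simp only [multivariateGaussian, zero_add]
    exact (Measure.pi_map_pi (f := fun _ => Matrix.toEuclideanCLM (𝕜 := ℝ) (CFC.sqrt S))
      (fun i => by fun_prop)).symm
  rw [hlaw, Measure.map_apply (by fun_prop) (isOpen_exists_norm_rowMul_lt d).measurableSet]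
  refine le_trans ?_ (measure_exists_norm_rowMul_lt hn hp ht hct)
  rw [← pi_stdGaussian_map_toLp]
  refine le_trans (measure_mono ?_) (Measure.le_map_apply (by fun_prop) _)
  rintro z ⟨v, hv⟩
  have hA := sqrt_posSemidef S
  rw [rowMul_toEuclideanCLM hA] at hv
  refine ⟨Matrix.toEuclideanCLM (𝕜 := ℝ) (CFC.sqrt S) v, hv.trans_le ?_⟩
  calc d * ‖v‖ ≤ c * minEigenvalue (CFC.sqrt S) * ‖v‖ := by gcongr
    _ = c * (minEigenvalue (CFC.sqrt S) * ‖v‖) := mul_assoc _ _ _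
    _ ≤ _ := mul_le_mul_of_nonneg_left (minEigenvalue_mul_norm_le hA v) hc

end Design

/-! ### Tail bounds for the estimation error. -/

section Noise

variable {n p : ℕ}

lemma multivariateGaussian_sq_smul_one (σ : ℝ) :
    multivariateGaussian 0 (σ ^ 2 • (1 : Matrix (Fin n) (Fin n) ℝ))
      = (stdGaussian (EuclideanSpace ℝ (Fin n))).map fun z => σ • z := by
  have : IsProbabilityMeasure ((stdGaussian (EuclideanSpace ℝ (Fin n))).map fun z => σ • z) :=
    Measure.isProbabilityMeasure_map (by fun_prop)
  apply Measure.ext_of_charFun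
  ext t
  rw [charFun_map_smul, charFun_stdGaussian,
    charFun_multivariateGaussian (Matrix.PosSemidef.one.smul (sq_nonneg σ))]
  have h : t.ofLp ⬝ᵥ (σ ^ 2 • (1 : Matrix (Fin n) (Fin n) ℝ)) *ᵥ t.ofLp = ‖σ • t‖ ^ 2 := by
    rw [Matrix.smul_mulVec, Matrix.one_mulVec, dotProduct_smul, norm_smul, mul_pow,
      EuclideanSpace.real_norm_sq_eq, Real.norm_eq_abs, sq_abs]
    simp [dotProduct, sq]
  rw [h]
  simp [neg_div]

lemma stdGaussian_abs_inner_gt_le {w : EuclideanSpace ℝ (Fin n)} (hw : ‖w‖ ≤ 1) {t : ℝ}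
    (ht : 0 ≤ t) :
    stdGaussian (EuclideanSpace ℝ (Fin n)) {z | t < |inner ℝ w z|} ≤
      ENNReal.ofReal (2 * Real.exp (-t ^ 2 / 2)) := by
  have key : ∀ w : EuclideanSpace ℝ (Fin n), ‖w‖ ≤ 1 →
      stdGaussian (EuclideanSpace ℝ (Fin n)) {z | inner ℝ w z ≤ -t} ≤
        ENNReal.ofReal (Real.exp (-t ^ 2 / 2)) := by
    intro w hw
    have h0 : ∫ z, (inner ℝ w z : ℝ) ∂stdGaussian (EuclideanSpace ℝ (Fin n)) = 0 :=
      integral_strongDual_stdGaussian (innerSL ℝ w)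
    have h := stdGaussian_real_lt_le (F := fun z => inner ℝ w z)
      (contDiff_const.inner ℝ contDiff_id) (fun z => by
        have : fderiv ℝ (fun z : EuclideanSpace ℝ (Fin n) => (inner ℝ w z : ℝ)) z = innerSL ℝ w :=
          (innerSL ℝ w).hasFDerivAt.fderiv
        rw [this, innerSL_apply_norm]
        exact hw) ht
    rw [h0, zero_sub] at h
    rw [← ofReal_measureReal]
    exact ENNReal.ofReal_le_ofReal h
  have hsub : {z : EuclideanSpace ℝ (Fin n) | t < |inner ℝ w z|} ⊆
      {z | inner ℝ w z ≤ -t} ∪ {z | inner ℝ (-w) z ≤ -t} := by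
    intro z hz
    have hz' : t < |inner ℝ w z| := hz
    rcases lt_abs.1 hz' with h | h
    · right
      simp only [Set.mem_ofPred_eq, inner_neg_left]
      linarith
    · left
      simp only [Set.mem_ofPred_eq]
      linarith
  refine (measure_mono hsub).trans ((measure_union_le _ _).trans ?_)
  rw [two_mul, ENNReal.ofReal_add (Real.exp_pos _).le (Real.exp_pos _).le]
  exact add_le_add (key w hw) (key (-w) (by rwa [norm_neg]))

/-- The strict inequality in the event keeps the case `σ = 0` valid, where the noise vanishes and
the event is null even at threshold `0`. -/
lemma noise_abs_inner_gt_le {σ s t : ℝ} (hσ : 0 ≤ σ) (hs : 0 < s) (ht : 0 ≤ t)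
    {w : EuclideanSpace ℝ (Fin n)} (hw : s * ‖w‖ ≤ 1) :
    multivariateGaussian 0 (σ ^ 2 • (1 : Matrix (Fin n) (Fin n) ℝ))
      {e | σ / s * t < |inner ℝ w e|} ≤ ENNReal.ofReal (2 * Real.exp (-t ^ 2 / 2)) := by
  have hm : MeasurableSet {e : EuclideanSpace ℝ (Fin n) | σ / s * t < |inner ℝ w e|} :=
    measurableSet_lt measurable_const (by fun_prop)
  rw [multivariateGaussian_sq_smul_one, Measure.map_apply (by fun_prop) hm]
  refine le_trans (measure_mono ?_) (stdGaussian_abs_inner_gt_le (w := s • w)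
    (by rwa [norm_smul, Real.norm_eq_abs, abs_of_pos hs]) ht)
  intro z hz
  have hz' : σ / s * t < |inner ℝ w (σ • z)| := hz
  rw [real_inner_smul_right, abs_mul, abs_of_nonneg hσ] at hz'
  rw [Set.mem_ofPred_eq, real_inner_smul_left, abs_mul, abs_of_pos hs]
  have h1 : σ * t < σ * (s * |inner ℝ w z|) := by
    calc σ * t = σ / s * t * s := by field_simp
      _ < σ * |inner ℝ w z| * s := mul_lt_mul_of_pos_right hz' hs
      _ = _ := by ring
  exact lt_of_mul_lt_mul_left h1 hσ

/-- The event that the design is well conditioned but some estimation error exceeds `D`. -/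
def noiseBadSet (n p : ℕ) (s D : ℝ) :
    Set ((Fin n → EuclideanSpace ℝ (Fin p)) × EuclideanSpace ℝ (Fin n)) :=
  {q | (∀ v, s * ‖v‖ ≤ ‖rowMul (WithLp.toLp 2 q.1) v‖) ∧
    ∃ j, D < |inner ℝ (olsRow (dataMatrix q.1) j) q.2|}

lemma measurable_olsRow (j : Fin p) :
    Measurable fun x : Fin n → EuclideanSpace ℝ (Fin p) => olsRow (dataMatrix x) j := by
  have hX : Continuous fun x : Fin n → EuclideanSpace ℝ (Fin p) => dataMatrix x :=
    continuous_matrix fun i k => by simp only [dataMatrix, Matrix.of_apply]; fun_prop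
  have hXt : Continuous fun x : Fin n → EuclideanSpace ℝ (Fin p) => (dataMatrix x)ᵀ :=
    hX.matrix_transpose
  have hg : Continuous fun x : Fin n → EuclideanSpace ℝ (Fin p) =>
      (dataMatrix x)ᵀ * dataMatrix x := hXt.matrix_mul hX
  have hadj := hg.matrix_adjugate.matrix_mul hXt
  unfold olsRow
  refine (WithLp.measurable_toLp 2 _).comp (measurable_pi_lambda _ fun i => ?_)
  -- The determinant and adjugate are continuous, and real inversion is measurable everywhere, with
  -- value `0` at `0`; singular Gram matrices need no separate treatment.
  have : ∀ x : Fin n → EuclideanSpace ℝ (Fin p),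
      (((dataMatrix x)ᵀ * dataMatrix x)⁻¹ * (dataMatrix x)ᵀ) j i
        = (((dataMatrix x)ᵀ * dataMatrix x).det)⁻¹ *
          ((((dataMatrix x)ᵀ * dataMatrix x).adjugate * (dataMatrix x)ᵀ) j i) := by
    intro x
    rw [Matrix.inv_def, Ring.inverse_eq_inv', Matrix.smul_mul, Matrix.smul_apply, smul_eq_mul]
  simp only [this]
  exact (hg.matrix_det.measurable.inv).mul (hadj.matrix_elem j i).measurable

lemma measurableSet_noiseBadSet (n p : ℕ) (s D : ℝ) : MeasurableSet (noiseBadSet n p s D) := by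
  refine MeasurableSet.inter ?_ ?_
  · have h := (isOpen_exists_norm_rowMul_lt (n := n) (p := p) s).measurableSet.compl.preimage
      (measurable_fst : Measurable (Prod.fst : (Fin n → EuclideanSpace ℝ (Fin p)) ×
        EuclideanSpace ℝ (Fin n) → _))
    have e : {q : (Fin n → EuclideanSpace ℝ (Fin p)) × EuclideanSpace ℝ (Fin n) |
        ∀ v, s * ‖v‖ ≤ ‖rowMul (WithLp.toLp 2 q.1) v‖} = Prod.fst ⁻¹'
        {x : Fin n → EuclideanSpace ℝ (Fin p) |
          ∃ v, ‖rowMul (WithLp.toLp 2 x) v‖ < s * ‖v‖}ᶜ := by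
      ext q
      simp
    rw [← e] at h
    exact h
  · have : {q : (Fin n → EuclideanSpace ℝ (Fin p)) × EuclideanSpace ℝ (Fin n) |
        ∃ j, D < |inner ℝ (olsRow (dataMatrix q.1) j) q.2|}
        = ⋃ j, {q | D < |inner ℝ (olsRow (dataMatrix q.1) j) q.2|} := by
      ext q; simp
    have h : MeasurableSet (⋃ j, {q : (Fin n → EuclideanSpace ℝ (Fin p)) ×
        EuclideanSpace ℝ (Fin n) | D < |inner ℝ (olsRow (dataMatrix q.1) j) q.2|}) := by
      refine MeasurableSet.iUnion fun j => measurableSet_lt measurable_const ?_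
      have h1 := (measurable_olsRow (n := n) j).comp
        (measurable_fst : Measurable (Prod.fst : (Fin n → EuclideanSpace ℝ (Fin p)) ×
          EuclideanSpace ℝ (Fin n) → _))
      have h2 : Measurable fun q : (Fin n → EuclideanSpace ℝ (Fin p)) × EuclideanSpace ℝ (Fin n) =>
        (inner ℝ (olsRow (dataMatrix q.1) j) q.2 : ℝ) := h1.inner measurable_snd
      simpa only [Real.norm_eq_abs] using h2.norm
    rw [← this] at h
    exact h

/-- Fubini with the design frozen: a slice over an ill-conditioned design is empty, and over a
well-conditioned one a union bound runs over the `p` rows. -/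
lemma prod_noiseBadSet_le {σ s t : ℝ} (hσ : 0 ≤ σ) (hs : 0 < s) (ht : 0 ≤ t)
    (μ : Measure (Fin n → EuclideanSpace ℝ (Fin p))) [IsProbabilityMeasure μ] :
    (μ.prod (multivariateGaussian 0 (σ ^ 2 • (1 : Matrix (Fin n) (Fin n) ℝ))))
      (noiseBadSet n p s (σ / s * t)) ≤ ENNReal.ofReal (p * (2 * Real.exp (-t ^ 2 / 2))) := by
  rw [Measure.prod_apply (measurableSet_noiseBadSet _ _ _ _)]
  refine (lintegral_mono (g := fun _ => ENNReal.ofReal (p * (2 * Real.exp (-t ^ 2 / 2))))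
    fun x => ?_).trans (by simp)
  by_cases hx : ∀ v : EuclideanSpace ℝ (Fin p), s * ‖v‖ ≤ ‖rowMul (WithLp.toLp 2 x) v‖
  · have hsub : Prod.mk x ⁻¹' noiseBadSet n p s (σ / s * t) ⊆
        ⋃ j, {e | σ / s * t < |inner ℝ (olsRow (dataMatrix x) j) e|} := by
      rintro e ⟨-, j, hj⟩
      exact Set.mem_iUnion.2 ⟨j, hj⟩
    refine (measure_mono hsub).trans ((measure_iUnion_fintype_le _ _).trans ?_)
    refine (Finset.sum_le_sum fun j _ =>
      noise_abs_inner_gt_le hσ hs ht (norm_olsRow_le hs hx j)).trans ?_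
    rw [Finset.sum_const, Finset.card_univ, Fintype.card_fin, nsmul_eq_mul,
      ENNReal.ofReal_mul (Nat.cast_nonneg p), ENNReal.ofReal_natCast]
  · have : Prod.mk x ⁻¹' noiseBadSet n p s (σ / s * t) = ∅ := by
      ext e
      simp only [Set.mem_preimage, Set.mem_empty_iff_false, iff_false]
      exact fun h => hx h.1
    rw [this, measure_empty]
    exact zero_le

end Noise

/-! ### Numerical constants. -/

section Constants

lemma tail_exponent {n p : ℕ} (hn : 0 < n) (hp : 0 < p) (α : ℝ) :
    (p : ℝ) * (2 * Real.exp (-(2 * √(n : ℝ) * √(Real.log p / (n : ℝ) ^ α)) ^ 2 / 2))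
      = 2 * (p : ℝ) ^ (1 - 2 * (n : ℝ) ^ (1 - α)) := by
  have hn' : (0 : ℝ) < n := by exact_mod_cast hn
  have hp' : (0 : ℝ) < p := by exact_mod_cast hp
  have hlog : 0 ≤ Real.log p := Real.log_natCast_nonneg p
  have hpow : 0 < (n : ℝ) ^ α := Real.rpow_pos_of_pos hn' α
  have h1 : -(2 * √(n : ℝ) * √(Real.log p / (n : ℝ) ^ α)) ^ 2 / 2
      = Real.log p * -(2 * (n : ℝ) ^ (1 - α)) := by
    rw [mul_pow, mul_pow, Real.sq_sqrt hn'.le, Real.sq_sqrt (by positivity),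
      Real.rpow_sub hn', Real.rpow_one]
    field_simp
  rw [h1, ← Real.rpow_def_of_pos hp', sub_eq_add_neg 1 (2 * (n : ℝ) ^ (1 - α)), Real.rpow_add hp', Real.rpow_one]
  ring

variable {n p : ℕ} {S : Matrix (Fin p) (Fin p) ℝ} {lam : ℝ}

lemma lam_le_minEigenvalue_mul (hp : 0 < p) (hS : S.PosSemidef)
    (hlam : lam = 0.9 * minEigenvalue (CFC.sqrt S) - rhoDiag S * √((p : ℝ) / n)) :
    lam ≤ minEigenvalue (CFC.sqrt S) * (0.9 - √((p : ℝ) / n)) := by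
  have h1 := mul_le_mul_of_nonneg_right (minEigenvalue_sqrt_le_rhoDiag hp hS)
    (Real.sqrt_nonneg ((p : ℝ) / n))
  rw [hlam]
  linarith

lemma minEigenvalue_sqrt_pos
    (hlam : lam = 0.9 * minEigenvalue (CFC.sqrt S) - rhoDiag S * √((p : ℝ) / n))
    (hlam_pos : 0 < lam) : 0 < minEigenvalue (CFC.sqrt S) := by
  have h1 : 0 ≤ rhoDiag S * √((p : ℝ) / n) :=
    mul_nonneg (Real.sqrt_nonneg _) (Real.sqrt_nonneg _)
  linarith

lemma design_bad_le (hn : 0 < n) (hp : 0 < p) (hS : S.PosSemidef)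
    (hlam : lam = 0.9 * minEigenvalue (CFC.sqrt S) - rhoDiag S * √((p : ℝ) / n))
    (hlam_pos : 0 < lam) :
    (Measure.pi fun _ : Fin n => multivariateGaussian (0 : EuclideanSpace ℝ (Fin p)) S)
      {x | ∃ v, ‖rowMul (WithLp.toLp 2 x) v‖ < √(n : ℝ) * lam * ‖v‖}
      ≤ ENNReal.ofReal (Real.exp (-(n : ℝ) / 200)) := by
  have hn' : (0 : ℝ) < n := by exact_mod_cast hn
  have hmin := minEigenvalue_sqrt_pos hlam hlam_pos
  have hle := lam_le_minEigenvalue_mul hp hS hlam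
  -- Positivity of `lam` thus forces `p < n`, as the comparison of `chiMean n` and `chiMean p`
  -- requires.
  have hgap : 0 < 0.9 - √((p : ℝ) / n) := pos_of_mul_pos_right (hlam_pos.trans_le hle) hmin.le
  have hsn : 0 < √(n : ℝ) := Real.sqrt_pos.2 hn'
  have hsq : √((p : ℝ) / n) * √(n : ℝ) = √(p : ℝ) := by
    rw [← Real.sqrt_mul (by positivity), div_mul_cancel₀ _ hn'.ne']
  have hpn : p ≤ n := by
    have h1 : (p : ℝ) / n < 1 := by
      have h2 : √((p : ℝ) / n) < 1 := by linarith
      rwa [Real.sqrt_lt' one_pos, one_pow] at h2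
    rw [div_lt_one hn'] at h1
    exact_mod_cast h1.le
  have hchi := sqrt_sub_sqrt_le_chiMean_sub hp hpn
  -- The choice gives `c + t = √n - √p`; the deviation `0.1 √n` accounts for both the factor `0.9`
  -- and the exponent `n / 200`.
  have h := pi_multivariateGaussian_exists_norm_rowMul_lt hn hp S
    (c := √(n : ℝ) * (0.9 - √((p : ℝ) / n))) (d := √(n : ℝ) * lam) (t := 0.1 * √(n : ℝ))
    (by positivity) (by positivity) (by linarith) (by
      rw [mul_assoc, mul_comm (0.9 - _)]
      exact mul_le_mul_of_nonneg_left hle hsn.le)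
  have ht : -(0.1 * √(n : ℝ)) ^ 2 / 2 = -(n : ℝ) / 200 := by
    rw [mul_pow, Real.sq_sqrt hn'.le]
    norm_num
    ring
  rwa [ht] at h

end Constants

/-! ### Union of the two bad events. -/

theorem theorem1 {Ω : Type*} [MeasurableSpace Ω] (P : Measure Ω) [IsProbabilityMeasure P]
    (n p : ℕ) (hn : 0 < n) (hp : 0 < p)
    (S : Matrix (Fin p) (Fin p) ℝ) (hS : S.PosSemidef)
    (β : Fin p → ℝ) (σ : ℝ) (hσ : 0 ≤ σ) (α : ℝ) (hα : α ∈ Set.Ioc (0 : ℝ) 1)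
    (x : Fin n → Ω → EuclideanSpace ℝ (Fin p)) (ε : Ω → EuclideanSpace ℝ (Fin n))
    (hx_law : ∀ i, HasLaw (x i) (multivariateGaussian 0 S) P)
    (hx_indep : iIndepFun x P)
    (hε_law : HasLaw ε (multivariateGaussian 0 (σ ^ 2 • (1 : Matrix (Fin n) (Fin n) ℝ))) P)
    (hxε_indep : IndepFun (fun ω i => x i ω) ε P)
    (lam : ℝ)
    (hlam : lam = 0.9 * minEigenvalue (CFC.sqrt S) - rhoDiag S * Real.sqrt ((p : ℝ) / n))
    (hlam_pos : 0 < lam)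
    (hβ : ∀ j ∈ coeffSupport β,
      4 * σ / lam * Real.sqrt (Real.log p / (n : ℝ) ^ α) < |β j|) :
    1 - 2 * (p : ℝ) ^ (1 - 2 * (n : ℝ) ^ (1 - α)) - Real.exp (-(n : ℝ) / 200) ≤
      P.real {ω |
        let X := dataMatrix fun i => x i ω
        IsUnit (Xᵀ * X) ∧
          TopIndexSetIs (coeffSupport β).card (olsEstimate X (response X β (ε ω)))
            (coeffSupport β)} := by
  classical
  have hn' : (0 : ℝ) < n := by exact_mod_cast hn
  have hsn : 0 < √(n : ℝ) := Real.sqrt_pos.2 hn'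
  set s := √(n : ℝ) * lam with hs_def
  have hs : 0 < s := mul_pos hsn hlam_pos
  set q := √(Real.log p / (n : ℝ) ^ α) with hq
  set t := 2 * √(n : ℝ) * q with ht_def
  have ht : 0 ≤ t := by positivity
  have hx_ae : AEMeasurable (fun ω i => x i ω) P :=
    aemeasurable_pi_lambda _ fun i => (hx_law i).aemeasurable
  have hx_map : P.map (fun ω i => x i ω)
      = Measure.pi fun _ : Fin n => multivariateGaussian (0 : EuclideanSpace ℝ (Fin p)) S := by
    rw [(iIndepFun_iff_map_fun_eq_pi_map fun i => (hx_law i).aemeasurable).1 hx_indep]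
    congr 1
    ext1 i
    exact (hx_law i).map_eq
  have hjoint : P.map (fun ω => ((fun i => x i ω), ε ω))
      = (Measure.pi fun _ : Fin n => multivariateGaussian (0 : EuclideanSpace ℝ (Fin p)) S).prod
        (multivariateGaussian 0 (σ ^ 2 • (1 : Matrix (Fin n) (Fin n) ℝ))) := by
    rw [(indepFun_iff_map_prod_eq_prod_map_map hx_ae hε_law.aemeasurable).1 hxε_indep, hx_map,
      hε_law.map_eq]
  set A := {ω |
        let X := dataMatrix fun i => x i ω
        IsUnit (Xᵀ * X) ∧
          TopIndexSetIs (coeffSupport β).card (olsEstimate X (response X β (ε ω)))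
            (coeffSupport β)} with hA
  set B₁ := {ω | ∃ v, ‖rowMul (WithLp.toLp 2 fun i => x i ω) v‖ < s * ‖v‖} with hB₁
  set B₂ := {ω | ((fun i => x i ω), ε ω) ∈ noiseBadSet n p s (σ / s * t)} with hB₂
  have hP₁ : P B₁ ≤ ENNReal.ofReal (Real.exp (-(n : ℝ) / 200)) := by
    refine le_trans (Measure.le_map_apply hx_ae
      {x : Fin n → EuclideanSpace ℝ (Fin p) | ∃ v, ‖rowMul (WithLp.toLp 2 x) v‖ < s * ‖v‖}) ?_
    rw [hx_map]
    exact design_bad_le hn hp hS hlam hlam_pos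
  have hP₂ : P B₂ ≤ ENNReal.ofReal (2 * (p : ℝ) ^ (1 - 2 * (n : ℝ) ^ (1 - α))) := by
    refine le_trans (Measure.le_map_apply (hx_ae.prodMk hε_law.aemeasurable)
      (noiseBadSet n p s (σ / s * t))) ?_
    rw [hjoint, ← tail_exponent hn hp α]
    exact prod_noiseBadSet_le hσ hs ht _
  have hD : 2 * (σ / s * t) = 4 * σ / lam * q := by
    rw [hs_def, ht_def]
    field_simp
    ring
  -- A cover and subadditivity suffice, so measurability of `A` is never needed.
  have hcover : Set.univ ⊆ A ∪ (B₁ ∪ B₂) := by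
    intro ω _
    by_contra hω
    simp only [Set.mem_union, not_or] at hω
    obtain ⟨hωA, hω₁, hω₂⟩ := hω
    have hwell : ∀ v : EuclideanSpace ℝ (Fin p),
        s * ‖v‖ ≤ ‖rowMul (WithLp.toLp 2 fun i => x i ω) v‖ := fun v => by
      by_contra h
      exact hω₁ ⟨v, not_le.1 h⟩
    have hunit := isUnit_gram hs hwell
    refine hωA ⟨hunit, topIndexSetIs_coeffSupport (D := σ / s * t) (fun j hj => ?_) fun j => ?_⟩
    · rw [hD]
      exact hβ j hj
    · rw [olsEstimate_response hunit, add_sub_cancel_left]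
      by_contra h
      exact hω₂ ⟨hwell, j, not_le.1 h⟩
  have h1 : (1 : ℝ) ≤ P.real A + (P.real B₁ + P.real B₂) := by
    calc (1 : ℝ) = P.real Set.univ := probReal_univ.symm
      _ ≤ P.real (A ∪ (B₁ ∪ B₂)) := measureReal_mono hcover
      _ ≤ P.real A + P.real (B₁ ∪ B₂) := measureReal_union_le _ _
      _ ≤ _ := by gcongr; exact measureReal_union_le _ _
  have h2 : P.real B₁ ≤ Real.exp (-(n : ℝ) / 200) :=
    ENNReal.toReal_le_of_le_ofReal (Real.exp_pos _).le hP₁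
  have h3 : P.real B₂ ≤ 2 * (p : ℝ) ^ (1 - 2 * (n : ℝ) ^ (1 - α)) :=
    ENNReal.toReal_le_of_le_ofReal (by positivity) hP₂
  linarith
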